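/- A triangulation of the plane is a cell decomposition of $\mathbb{R}^2$ obtained by gluing the sides of a family of triangles in pairs, so that the resulting surface is homeomorphic to $\mathbb{R}^2$ (loops and multiple edges are allowed). The degree of a vertex is the number of edges at it, loops being counted twice, and a vertex is called exceptional if its degree is not $6$. The regular triangulation of the plane is the tiling by unit equilateral triangles, with six triangles at every vertex. Two triangulations are isomorphic near infinity if, after finitely many triangles are deleted from each of them, the remaining triangles correspond bijectively, side by side, so that gluings of sides are preserved in both directions and the cyclic order of the sides is either preserved in all triangles or reversed in all triangles. Theorem (Dress). A triangulation of the plane with exactly two exceptional vertices is not isomorphic near infinity to the regular triangulation. -/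

import Mathlib

/-- A surface presented by gluing triangles: a family of triangles, each with its three sides
numbered cyclically by `Fin 3`, together with a pairing of all the sides.  The triangle `f` has
corners `0, 1, 2` in positive cyclic order, and the side `(f, i)` is directed from corner `i` to
corner `i + 1`.  A side is glued to its partner with reversed direction, as is the case
on an oriented surface all of whose triangles are positively oriented.
Two sides of the same triangle may be glued, so loops and multiple edges are allowed. -/
structure TriangleGluing where
  /-- The triangles. -/
  Face : Type*
  /-- The side to which a given side is glued. -/
  mate : Face × Fin 3 → Face × Fin 3
  mate_mate : ∀ s, mate (mate s) = s
  mate_ne : ∀ s, mate s ≠ s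

namespace TriangleGluing

/-- Sides of triangles; the side `(f, i)` of `f` is directed from corner `i` to corner `i + 1`. -/
abbrev Side (T : TriangleGluing) : Type _ := T.Face × Fin 3

/-- The cyclically next side of the same triangle. -/
def next (T : TriangleGluing) : Equiv.Perm T.Side where
  toFun s := (s.1, s.2 + 1)
  invFun s := (s.1, s.2 - 1)
  left_inv s := by simp
  right_inv s := by simp

/-- The pairing of sides, as a permutation. -/
def matePerm (T : TriangleGluing) : Equiv.Perm T.Side where
  toFun := T.mate
  invFun := T.mate
  left_inv := T.mate_mate
  right_inv := T.mate_mate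

/-- The permutation that turns each directed side around its starting vertex: the side preceding
`s` in its triangle ends where `s` starts, so its partner starts there too. -/
def rotate (T : TriangleGluing) : Equiv.Perm T.Side := T.next.symm.trans T.matePerm

/-- The vertices of the glued surface: the orbits of directed sides under turning around their
starting vertex. -/
def Vertex (T : TriangleGluing) : Type _ := Quotient (Equiv.Perm.SameCycle.setoid T.rotate)

/-- The starting vertex of a directed side. -/
def start (T : TriangleGluing) (s : T.Side) : T.Vertex :=
  Quotient.mk (Equiv.Perm.SameCycle.setoid T.rotate) s

/-- The degree of a vertex: the number of directed sides that start there, which is the number of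
edges at the vertex with loops counted twice. -/
noncomputable def degree (T : TriangleGluing) (v : T.Vertex) : ℕ∞ :=
  {s : T.Side | T.start s = v}.encard

/-- The exceptional vertices are those of degree different from `6`. -/
def exceptional (T : TriangleGluing) : Set T.Vertex := {v | T.degree v ≠ 6}

/-- The point at parameter `t` on side `i` of the standard triangle, from corner `i` at `t = 0`
to corner `i + 1` at `t = 1`, in barycentric coordinates. -/
def sidePoint (i : Fin 3) (t : unitInterval) : stdSimplex ℝ (Fin 3) :=
  ⟨fun j => if j = i then 1 - (t : ℝ) else if j = i + 1 then (t : ℝ) else 0, by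
    refine ⟨fun j => ?_, ?_⟩
    · have h0 := t.2.1
      have h1 := t.2.2
      dsimp only
      split_ifs <;> linarith
    · fin_cases i <;> simp [Fin.sum_univ_three]⟩

/-- Each point of a side is identified with the corresponding point of the partner side, which is
traversed in the opposite direction. -/
inductive Glued (T : TriangleGluing) :
    (Σ _ : T.Face, stdSimplex ℝ (Fin 3)) → (Σ _ : T.Face, stdSimplex ℝ (Fin 3)) → Prop
  | side (s : T.Side) (t : unitInterval) :
      Glued T ⟨s.1, sidePoint s.2 t⟩ ⟨(T.mate s).1, sidePoint (T.mate s).2 (unitInterval.symm t)⟩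

/-- The glued surface: the disjoint union of the closed triangles modulo the equivalence relation
generated by the side identifications, with the quotient topology. -/
def Realization (T : TriangleGluing) : Type _ := Quot T.Glued

instance (T : TriangleGluing) : TopologicalSpace T.Realization :=
  inferInstanceAs (TopologicalSpace (Quot T.Glued))

/-- The gluing is a triangulation of the plane: the glued surface is homeomorphic to `ℝ²`. -/
def IsPlane (T : TriangleGluing) : Prop :=
  Nonempty (T.Realization ≃ₜ EuclideanSpace ℝ (Fin 2))

/-- Two gluings are isomorphic near infinity: after deleting finitely many triangles from each,
there is a bijection between the remaining sides which maps triangles to triangles, either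
preserving the cyclic order of the sides in all of them or reversing it in all of them, and which
preserves and reflects the gluing of sides. -/
def IsoNearInfinity (S T : TriangleGluing) : Prop :=
  ∃ (A : Set S.Face) (B : Set T.Face), A.Finite ∧ B.Finite ∧
    ∃ φ : {s : S.Side // s.1 ∉ A} ≃ {s : T.Side // s.1 ∉ B},
      ((∀ s s', s'.1 = S.next s.1 → (φ s').1 = T.next (φ s).1) ∨
        (∀ s s', s'.1 = S.next s.1 → (φ s').1 = T.next.symm (φ s).1)) ∧
      (∀ s s', s'.1 = S.mate s.1 ↔ (φ s').1 = T.mate (φ s).1)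

/-- The gluing rule of the regular triangular tiling. -/
def regularMate : (ℤ × ℤ × Bool) × Fin 3 → (ℤ × ℤ × Bool) × Fin 3
  | ((m, n, true), 0) => ((m, n - 1, false), 0)
  | ((m, n, true), 1) => ((m, n, false), 1)
  | ((m, n, true), 2) => ((m - 1, n, false), 2)
  | ((m, n, false), 0) => ((m, n + 1, true), 0)
  | ((m, n, false), 1) => ((m, n, true), 1)
  | ((m, n, false), 2) => ((m + 1, n, true), 2)

/-- The corners of the triangles of the regular tiling.  The pair `(x, y)` stands for the point
`x + y ω` of the triangular lattice, with `ω = exp (π i / 3)`.  The triangle `(m, n, true)` has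
corners `m + n ω`, `m + n ω + 1`, `m + n ω + ω`, and the triangle `(m, n, false)` has
corners `m + n ω + 1 + ω`, `m + n ω + ω`, `m + n ω + 1`, in positive order. -/
def regularCorner : (ℤ × ℤ × Bool) → Fin 3 → ℤ × ℤ
  | (m, n, true), 0 => (m, n)
  | (m, n, true), 1 => (m + 1, n)
  | (m, n, true), 2 => (m, n + 1)
  | (m, n, false), 0 => (m + 1, n + 1)
  | (m, n, false), 1 => (m, n + 1)
  | (m, n, false), 2 => (m + 1, n)

/-- The regular triangulation of the plane: the tiling by unit equilateral triangles, whose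
vertices are the points of the triangular lattice. -/
def regular : TriangleGluing where
  Face := ℤ × ℤ × Bool
  mate := regularMate
  mate_mate := by
    rintro ⟨⟨m, n, b⟩, i⟩
    cases b <;> fin_cases i <;> simp [regularMate]
  mate_ne := by
    rintro ⟨⟨m, n, b⟩, i⟩
    cases b <;> fin_cases i <;> simp [regularMate]

/-- Glued sides of the regular tiling join the same two lattice points, in opposite directions. -/
theorem regularCorner_mate (s : (ℤ × ℤ × Bool) × Fin 3) :
    regularCorner (regularMate s).1 (regularMate s).2 = regularCorner s.1 (s.2 + 1) ∧
      regularCorner (regularMate s).1 ((regularMate s).2 + 1) = regularCorner s.1 s.2 := by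
  obtain ⟨⟨m, n, b⟩, i⟩ := s
  cases b <;> fin_cases i <;> simp [regularMate, regularCorner]

end TriangleGluing

/-! Suppose `T` agrees with the regular tiling near infinity. Let `K` be a finite core outside which
`T` looks like the exterior of a large rhombus, with `V` vertices, `E` edges and `F` triangles.

Euler characteristic. A cocycle on `K` extends to the plane by pulling back along the retraction
`clamp` onto the rhombus; on the plane it is a coboundary, hence so it is on `K`. Therefore `E + 1 ≤
V + F` (`ncard_edgesOf_lt`). Counting sides around `K`, where the collar is that of a rhombus, turns
this into: the two exceptional degrees add up to at most `12`. Being positive and different from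
`6`, neither is a multiple of `6`.

Development. Make all triangles equilateral and let `-ω` be a primitive sixth root of unity. For a
point `q` of the developed plane, let `P s` be the position of `q` in the coordinate in which the
side `s` runs from `0` to `1`. Then `P (next s) = ω ^ 2 * (P s - 1)` and `P (mate s) = 1 - P s`; a
global `P` exists exactly when the holonomy has a common fixed point. The obstruction lies in a
complex of twisted cochains: faces of `K` plus one value at infinity, edges of `K`, vertices of `K`
of degree `6`. The first map is injective, because the holonomy about an exceptional vertex is
nontrivial. The second is surjective, because `K` is connected and contains an exceptional vertex.
Comparing dimensions with Euler's inequality forces exactness and equality (`exists_development`).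
So `P` exists and the two degrees add up to exactly `12`.

Contradiction. Turning about a vertex multiplies `P` by `-ω`, so `P` vanishes on all `12` sides
starting at exceptional vertices. Walking straight for `m` steps is injective and adds `m` to `P`.
For suitable `m` this gives `12` sides outside `K` with `P = m`. In the regular tiling at most six
sides share a value: the direction, one of six, determines the side. -/

namespace TriangleGluing

/-! ### Topology of the plane: potentials and connectedness -/

theorem Glued.eq_of_sidePoint (T : TriangleGluing) (s : T.Side) (t : unitInterval) :
    (Quot.mk T.Glued ⟨s.1, sidePoint s.2 t⟩ : T.Realization) =
      Quot.mk T.Glued ⟨(T.mate s).1, sidePoint (T.mate s).2 (unitInterval.symm t)⟩ :=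
  Quot.sound (Glued.side s t)

/-- The continuous map from the glued surface assembled from compatible continuous maps on the
triangles. -/
theorem exists_continuous_lift (T : TriangleGluing) {Y : Type*} [TopologicalSpace Y]
    (F : T.Face → stdSimplex ℝ (Fin 3) → Y) (hF : ∀ f, Continuous (F f))
    (hglue : ∀ (s : T.Side) (t : unitInterval), F s.1 (sidePoint s.2 t) =
      F (T.mate s).1 (sidePoint (T.mate s).2 (unitInterval.symm t))) :
    ∃ g : C(T.Realization, Y), ∀ f x, g (Quot.mk T.Glued ⟨f, x⟩) = F f x := by
  refine ⟨⟨Quot.lift (fun p => F p.1 p.2) ?_, ?_⟩, fun f x => rfl⟩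
  · rintro _ _ ⟨s, t⟩
    exact hglue s t
  · exact continuous_coinduced_dom.2 (continuous_sigma hF)

theorem continuous_triangle (T : TriangleGluing) (f : T.Face) :
    Continuous fun x : stdSimplex ℝ (Fin 3) => (Quot.mk T.Glued ⟨f, x⟩ : T.Realization) :=
  (continuous_coinduced_rng (f := Quot.mk T.Glued)).comp
    (continuous_sigmaMk (σ := fun _ : T.Face => stdSimplex ℝ (Fin 3)) (i := f))

/-- The plane is simply connected, so maps to the circle lift through the covering by `ℝ`. Apart
from connectedness, this is the only topological property of the plane that the proof needs. -/
theorem IsPlane.exists_lift {T : TriangleGluing} (h : T.IsPlane)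
    (f : C(T.Realization, UnitAddCircle)) :
    ∃ g : C(T.Realization, ℝ), ∀ x, ((g x : ℝ) : UnitAddCircle) = f x := by
  obtain ⟨e⟩ := h
  obtain ⟨r, hr⟩ := QuotientAddGroup.mk_surjective (f (e.symm 0))
  obtain ⟨g, ⟨-, hg⟩, -⟩ := (AddCircle.isCoveringMap_coe (1 : ℝ)).existsUnique_continuousMap_lifts
    (f.comp (e.symm : C(EuclideanSpace ℝ (Fin 2), T.Realization))) (0 : EuclideanSpace ℝ (Fin 2))
    r hr
  refine ⟨g.comp (e : C(T.Realization, EuclideanSpace ℝ (Fin 2))), fun x => ?_⟩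
  have := congrFun hg (e x)
  simpa using this

/-- On the plane, every integral cocycle is a coboundary. -/
theorem IsPlane.exists_potential {T : TriangleGluing} (h : T.IsPlane) (c : T.Side → ℤ)
    (hanti : ∀ s, c (T.mate s) = -c s) (hclosed : ∀ f, c (f, 0) + c (f, 1) + c (f, 2) = 0) :
    ∃ ψ : T.Side → ℤ, (∀ s, ψ (T.next s) = ψ s + c s) ∧ ∀ s, ψ (T.mate s) = ψ (T.next s) := by
  -- The affine function on each triangle whose increments along the sides are the values of `c`;
  -- its corner values are the integers `a`. Modulo `1` these functions agree along glued sides.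
  set F : T.Face → stdSimplex ℝ (Fin 3) → ℝ := fun f x => x.1 1 * c (f, 0) - x.1 2 * c (f, 2)
    with hFdef
  have hFc : ∀ f, Continuous (F f) := by
    intro f
    have h1 : ∀ j : Fin 3, Continuous fun x : stdSimplex ℝ (Fin 3) => x.1 j := fun j =>
      (continuous_apply j).comp continuous_subtype_val
    exact ((h1 1).mul continuous_const).sub ((h1 2).mul continuous_const)
  set a : T.Side → ℤ := fun s => if s.2 = 0 then 0 else if s.2 = 1 then c (s.1, 0) else -c (s.1, 2)
    with ha
  have hside : ∀ (s : T.Side) (t : unitInterval), F s.1 (sidePoint s.2 t) = a s + t * c s := by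
    rintro ⟨f, i⟩ t
    have hc : (c (f, 0) : ℝ) + c (f, 1) + c (f, 2) = 0 := by exact_mod_cast hclosed f
    fin_cases i <;> simp [hFdef, ha, sidePoint]
    · linear_combination -(t : ℝ) * hc
    · ring
  have hnext : ∀ s, a (T.next s) = a s + c s := by
    rintro ⟨f, i⟩
    have := hclosed f
    fin_cases i <;> simp [ha, next] <;> linarith
  obtain ⟨g, hg⟩ := T.exists_continuous_lift (fun f x => ((F f x : ℝ) : UnitAddCircle))
    (fun f => (AddCircle.continuous_mk' 1).comp (hFc f)) (by
      intro s t
      rw [hside, hside, hanti, ← sub_eq_zero, ← AddCircle.coe_sub, AddCircle.coe_eq_zero_iff]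
      refine ⟨a s - a (T.mate s) + c s, ?_⟩
      simp
      ring)
  obtain ⟨G, hG⟩ := h.exists_lift g
  set d : T.Face → stdSimplex ℝ (Fin 3) → ℝ := fun f x => G (Quot.mk T.Glued ⟨f, x⟩) - F f x
  have hd : ∀ f x, ∃ n : ℤ, (n : ℝ) = d f x := by
    intro f x
    have h1 := hG (Quot.mk T.Glued ⟨f, x⟩)
    rw [hg, ← sub_eq_zero, ← AddCircle.coe_sub, AddCircle.coe_eq_zero_iff] at h1
    obtain ⟨n, hn⟩ := h1
    exact ⟨n, by simpa using hn⟩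
  -- An integer-valued continuous function on a connected triangle is constant. Hence the lift `G`
  -- is `F` plus an integer `m` on each triangle, and `m + a` is the value of `G` at the starting
  -- corner.
  have hconst : ∀ f x y, d f x = d f y := by
    intro f x y
    have hpre : IsPreconnected (Set.univ : Set (stdSimplex ℝ (Fin 3))) :=
      Subtype.preconnectedSpace (convex_stdSimplex ℝ (Fin 3)).isPreconnected |>.isPreconnected_univ
    have hc : Continuous (d f) := (G.continuous.comp (T.continuous_triangle f)).sub (hFc f)
    choose n hn using hd f
    have hn' : Continuous n := by
      have : Topology.IsInducing (Int.cast : ℤ → ℝ) :=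
        Int.isClosedEmbedding_coe_real.isInducing
      refine this.continuous_iff.2 ?_
      have h2 : (Int.cast : ℤ → ℝ) ∘ n = d f := funext hn
      rwa [h2]
    have := hpre.constant hn'.continuousOn (Set.mem_univ x) (Set.mem_univ y)
    rw [← hn, ← hn, this]
  choose m hm using fun f => hd f (sidePoint 0 0)
  have hval : ∀ (s : T.Side) (t : unitInterval),
      G (Quot.mk T.Glued ⟨s.1, sidePoint s.2 t⟩) = m s.1 + (a s + t * c s) := by
    intro s t
    have h1 : d s.1 (sidePoint s.2 t) = m s.1 := by rw [hm, hconst]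
    rw [← hside, ← h1]
    simp [d]
  refine ⟨fun s => m s.1 + a s, fun s => ?_, fun s => ?_⟩
  · change m s.1 + a (T.next s) = _
    rw [hnext]; ring
  · change _ = m s.1 + a (T.next s)
    have h1 := hval s 1
    rw [Glued.eq_of_sidePoint, hval] at h1
    rw [hnext]
    have h2 : (m (T.mate s).1 : ℝ) + a (T.mate s) = m s.1 + (a s + c s) := by simpa using h1
    exact_mod_cast h2

/-- On the plane, a property of sides that passes to the next side and to the partner holds for
all sides as soon as it holds for one. -/
theorem IsPlane.side_induction {T : TriangleGluing} (h : T.IsPlane) {Q : T.Side → Prop}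
    (hnext : ∀ s, Q s → Q (T.next s)) (hmate : ∀ s, Q s → Q (T.mate s)) {s₀ : T.Side} (h₀ : Q s₀)
    (s : T.Side) : Q s := by
  classical
  have hall : ∀ f i j, Q (f, i) → Q (f, j) := by
    intro f i j hi
    have h1 := hnext _ hi
    have h2 := hnext _ h1
    simp only [next, Equiv.coe_fn_mk] at h1 h2
    fin_cases i <;> fin_cases j <;> first | exact hi | exact h1 | exact h2
  -- The truth value of `Q` is constant on triangles and compatible with the gluing, hence a
  -- continuous map from a connected surface to a discrete space.
  obtain ⟨g, hg⟩ := T.exists_continuous_lift (Y := Bool) (fun f _ => decide (Q (f, 0)))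
    (fun f => continuous_const) (by
      intro s t
      refine decide_eq_decide.2 ⟨fun hq => ?_, fun hq => ?_⟩
      · exact hall _ _ 0 (hmate _ (hall _ _ s.2 hq))
      · have := hmate _ (hall _ _ (T.mate s).2 hq)
        rw [Prod.mk.eta, T.mate_mate] at this
        exact hall _ _ 0 this)
  have hpre : PreconnectedSpace T.Realization := by
    obtain ⟨e⟩ := h
    exact e.symm.surjective.denseRange.preconnectedSpace e.symm.continuous
  have h1 := PreconnectedSpace.constant hpre g.continuous
    (x := Quot.mk T.Glued ⟨s₀.1, sidePoint 0 0⟩) (y := Quot.mk T.Glued ⟨s.1, sidePoint 0 0⟩)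
  rw [hg, hg] at h1
  exact hall s.1 0 s.2 ((decide_eq_decide.1 h1).1 (hall _ s₀.2 0 h₀))

end TriangleGluing

/-! ### Finite orbits of permutations -/

theorem Equiv.Perm.SameCycle.exists_iterate_lt {α : Type*} {π : Equiv.Perm α} {a b : α} {p : ℕ}
    (hp : 0 < p) (ha : π^[p] a = a) (h : π.SameCycle a b) : ∃ j < p, π^[j] a = b := by
  obtain ⟨i, rfl⟩ := h
  have hz : (0 : ℤ) < p := by exact_mod_cast hp
  have hfix : ∀ k : ℤ, (π ^ ((p : ℤ) * k)) a = a := by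
    intro k
    rw [zpow_mul, zpow_natCast]
    have h1 : Function.IsFixedPt (π ^ p) a := by
      rw [Function.IsFixedPt, ← Equiv.Perm.iterate_eq_pow]; exact ha
    exact Function.IsFixedPt.perm_zpow h1 k
  refine ⟨(i % p).toNat, by have := Int.emod_lt_of_pos i hz; have := Int.emod_nonneg i hz.ne'; omega, ?_⟩
  rw [Equiv.Perm.iterate_eq_pow, ← zpow_natCast, Int.toNat_of_nonneg (Int.emod_nonneg i hz.ne')]
  conv_rhs => rw [← Int.emod_add_mul_ediv i p, zpow_add, Equiv.Perm.mul_apply, hfix]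

theorem Equiv.Perm.sameCycle_iterate {α : Type*} (π : Equiv.Perm α) (a : α) (n : ℕ) :
    π.SameCycle a (π^[n] a) := ⟨n, by rw [Equiv.Perm.iterate_eq_pow, zpow_natCast]⟩

/-- A finite orbit of a permutation is a cycle whose length is the size of the orbit. -/
theorem Equiv.Perm.orbit_of_encard {α : Type*} {π : Equiv.Perm α} {a : α} {n : ℕ}
    (h : {b | π.SameCycle a b}.encard = n) :
    π^[n] a = a ∧ ∀ i < n, ∀ j < n, π^[i] a = π^[j] a → i = j := by
  have hfin : {b | π.SameCycle a b}.Finite := Set.finite_of_encard_eq_coe h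
  have hper : a ∈ Function.periodicPts π := by
    by_contra hnot
    have hinj : Function.Injective fun j : ℕ => π^[j] a := by
      intro i j hij
      by_contra hne
      wlog hlt : i < j generalizing i j
      · exact this hij.symm (Ne.symm hne) (by omega)
      apply hnot
      refine Function.mk_mem_periodicPts (n := j - i) (by omega) ?_
      apply π.injective.iterate i
      dsimp only at hij
      rw [← Function.iterate_add_apply, show i + (j - i) = j by omega, hij]
    refine Set.infinite_range_of_injective hinj (hfin.subset ?_)
    rintro _ ⟨j, rfl⟩
    exact π.sameCycle_iterate a j
  have hp := Function.minimalPeriod_pos_of_mem_periodicPts hper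
  have hq := Function.isPeriodicPt_minimalPeriod π a
  have hset : {b | π.SameCycle a b} =
      (fun j => π^[j] a) '' (Finset.range (Function.minimalPeriod π a) : Set ℕ) := by
    ext b
    constructor
    · intro hb
      obtain ⟨j, hj, rfl⟩ := hb.exists_iterate_lt hp hq
      exact ⟨j, by simpa using hj, rfl⟩
    · rintro ⟨j, -, rfl⟩
      exact π.sameCycle_iterate a j
  have hinj : Set.InjOn (fun j => π^[j] a)
      (Finset.range (Function.minimalPeriod π a) : Set ℕ) := by
    rw [Finset.coe_range]
    exact Function.iterate_injOn_Iio_minimalPeriod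
  rw [hset, hinj.encard_image, Set.encard_coe_eq_coe_finsetCard, Finset.card_range] at h
  have hn : Function.minimalPeriod π a = n := by exact_mod_cast h
  subst hn
  refine ⟨hq, fun i hi j hj hij => hinj ?_ ?_ hij⟩ <;> simpa

/-! ### Sides around a vertex -/

namespace TriangleGluing

theorem rotate_apply (T : TriangleGluing) (s : T.Side) :
    T.rotate s = T.mate (T.next.symm s) := rfl

theorem next_symm_apply (T : TriangleGluing) (s : T.Side) :
    T.next.symm s = T.next (T.next s) := by
  rw [Equiv.symm_apply_eq]
  obtain ⟨f, i⟩ := s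
  fin_cases i <;> simp [next]

theorem mate_injective (T : TriangleGluing) : Function.Injective T.mate := T.matePerm.injective

theorem rotate_next (T : TriangleGluing) (s : T.Side) : T.rotate (T.next s) = T.mate s := by
  rw [rotate_apply, Equiv.symm_apply_apply]

theorem start_eq_iff (T : TriangleGluing) {s t : T.Side} :
    T.start s = T.start t ↔ T.rotate.SameCycle s t := Quotient.eq (r := Equiv.Perm.SameCycle.setoid T.rotate)

theorem start_surjective (T : TriangleGluing) : Function.Surjective T.start := Quotient.mk_surjective

theorem start_rotate (T : TriangleGluing) (s : T.Side) : T.start (T.rotate s) = T.start s :=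
  T.start_eq_iff.2 (Equiv.Perm.sameCycle_apply_left.2 (Equiv.Perm.SameCycle.refl _ _))

theorem start_iterate (T : TriangleGluing) (s : T.Side) (n : ℕ) :
    T.start (T.rotate^[n] s) = T.start s :=
  (T.start_eq_iff.2 (T.rotate.sameCycle_iterate s n)).symm

theorem start_next (T : TriangleGluing) (s : T.Side) : T.start (T.next s) = T.start (T.mate s) := by
  rw [← rotate_next, start_rotate]

theorem exists_iterate_of_start_eq (T : TriangleGluing) {s t : T.Side} {p : ℕ} (hp : 0 < p)
    (hs : T.rotate^[p] s = s) (h : T.start t = T.start s) : ∃ j < p, T.rotate^[j] s = t :=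
  (T.start_eq_iff.1 h.symm).exists_iterate_lt hp hs

theorem iterate_of_degree (T : TriangleGluing) {s : T.Side} {n : ℕ}
    (h : T.degree (T.start s) = n) :
    T.rotate^[n] s = s ∧ ∀ i < n, ∀ j < n, T.rotate^[i] s = T.rotate^[j] s → i = j := by
  refine Equiv.Perm.orbit_of_encard ?_
  rw [← h, degree]
  congr 1
  ext t
  exact T.start_eq_iff.symm.trans eq_comm

theorem degree_of_iterate (T : TriangleGluing) {s : T.Side} {n : ℕ} (hn : 0 < n)
    (h : T.rotate^[n] s = s)
    (hinj : ∀ i < n, ∀ j < n, T.rotate^[i] s = T.rotate^[j] s → i = j) :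
    T.degree (T.start s) = n := by
  have hset : {t | T.start t = T.start s} =
      (fun j => T.rotate^[j] s) '' (Finset.range n : Set ℕ) := by
    ext t
    constructor
    · intro ht
      obtain ⟨j, hj, rfl⟩ := T.exists_iterate_of_start_eq hn h ht
      exact ⟨j, by simpa using hj, rfl⟩
    · rintro ⟨j, -, rfl⟩
      exact T.start_iterate s j
  have hinj' : Set.InjOn (fun j => T.rotate^[j] s) (Finset.range n : Set ℕ) := by
    intro i hi j hj hij
    exact hinj i (by simpa using hi) j (by simpa using hj) hij
  rw [degree, hset, hinj'.encard_image, Set.encard_coe_eq_coe_finsetCard, Finset.card_range]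

/-- The vertices of the triangles in a given set. -/
def verticesOf (T : TriangleGluing) (A : Set T.Face) : Set T.Vertex := T.start '' {s | s.1 ∈ A}

/-- The sides of the triangles in a given set, together with their partners. -/
def sidesOf (T : TriangleGluing) (A : Set T.Face) : Set T.Side := {s | s.1 ∈ A ∨ (T.mate s).1 ∈ A}

theorem mate_mem_sidesOf (T : TriangleGluing) {A : Set T.Face} {s : T.Side} :
    T.mate s ∈ T.sidesOf A ↔ s ∈ T.sidesOf A := by
  simp only [sidesOf, Set.mem_ofPred_eq, T.mate_mate]
  exact or_comm

theorem start_mem_verticesOf (T : TriangleGluing) {A : Set T.Face} {s : T.Side}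
    (hs : s ∈ T.sidesOf A) : T.start s ∈ T.verticesOf A := by
  rcases hs with hs | hs
  · exact ⟨s, hs, rfl⟩
  · refine ⟨T.next (T.mate s), hs, ?_⟩
    rw [start_next, T.mate_mate]

/-! ### The regular triangulation -/

/-- The rotation of the regular triangulation about the starting vertex of a side. -/
def regularRotate : (ℤ × ℤ × Bool) × Fin 3 → (ℤ × ℤ × Bool) × Fin 3
  | ((m, n, true), 0) => ((m - 1, n, false), 2)
  | ((m, n, true), 1) => ((m, n - 1, false), 0)
  | ((m, n, true), 2) => ((m, n, false), 1)
  | ((m, n, false), 0) => ((m + 1, n, true), 2)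
  | ((m, n, false), 1) => ((m, n + 1, true), 0)
  | ((m, n, false), 2) => ((m, n, true), 1)

theorem coe_regular_rotate : ⇑regular.rotate = regularRotate := by
  funext s
  obtain ⟨⟨m, n, b⟩, i⟩ := s
  cases b <;> fin_cases i <;> rfl

theorem regularRotate_iterate_six (s : (ℤ × ℤ × Bool) × Fin 3) : regularRotate^[6] s = s := by
  obtain ⟨⟨m, n, b⟩, i⟩ := s
  cases b <;> fin_cases i <;> simp [regularRotate]

theorem regularRotate_iterate_injective (s : (ℤ × ℤ × Bool) × Fin 3) :
    ∀ i < 6, ∀ j < 6, regularRotate^[i] s = regularRotate^[j] s → i = j := by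
  obtain ⟨⟨m, n, b⟩, k⟩ := s
  intro i hi j hj
  cases b <;> fin_cases k <;> interval_cases i <;> interval_cases j <;> simp [regularRotate]

theorem regular_rotate_six (s : regular.Side) : regular.rotate^[6] s = s := by
  rw [coe_regular_rotate]
  exact regularRotate_iterate_six s

theorem regular_rotate_injective (s : regular.Side) :
    ∀ i < 6, ∀ j < 6, regular.rotate^[i] s = regular.rotate^[j] s → i = j := by
  rw [coe_regular_rotate]
  exact regularRotate_iterate_injective s

theorem regularCorner_rotate (s : regular.Side) :
    regularCorner (regular.rotate s).1 (regular.rotate s).2 = regularCorner s.1 s.2 := by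
  rw [coe_regular_rotate]
  obtain ⟨⟨m, n, b⟩, i⟩ := s
  cases b <;> fin_cases i <;> simp [regularRotate, regularCorner]

theorem regularCorner_iterate (s : regular.Side) (k : ℕ) :
    regularCorner (regular.rotate^[k] s).1 (regular.rotate^[k] s).2 = regularCorner s.1 s.2 := by
  induction k with
  | zero => rfl
  | succ k ih => rw [Function.iterate_succ_apply', regularCorner_rotate, ih]

/-- The side from `x` to `x + 1` of the triangle above it. -/
def regularBase (x : ℤ × ℤ) : regular.Side := ((x.1, x.2, true), 0)

theorem exists_regularRotate_iterate (s : (ℤ × ℤ × Bool) × Fin 3) :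
    ∃ j < 6, regularRotate^[j] (((regularCorner s.1 s.2).1, (regularCorner s.1 s.2).2, true), 0) =
      s := by
  obtain ⟨⟨m, n, b⟩, i⟩ := s
  cases b <;> fin_cases i
  · exact ⟨3, by norm_num, by simp [regularRotate, regularCorner]⟩
  · exact ⟨5, by norm_num, by simp [regularRotate, regularCorner]⟩
  · exact ⟨1, by norm_num, by simp [regularRotate, regularCorner]⟩
  · exact ⟨0, by norm_num, by simp [regularCorner]⟩
  · exact ⟨2, by norm_num, by simp [regularRotate, regularCorner]⟩
  · exact ⟨4, by norm_num, by simp [regularRotate, regularCorner]⟩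

theorem exists_iterate_regularBase (s : regular.Side) :
    ∃ j < 6, regular.rotate^[j] (regularBase (regularCorner s.1 s.2)) = s := by
  rw [coe_regular_rotate]
  exact exists_regularRotate_iterate s

theorem regular_start_eq_iff {s t : regular.Side} :
    regular.start s = regular.start t ↔ regularCorner s.1 s.2 = regularCorner t.1 t.2 := by
  constructor
  · intro h
    obtain ⟨j, -, rfl⟩ := regular.exists_iterate_of_start_eq (by norm_num) (regular_rotate_six t) h
    exact regularCorner_iterate t j
  · intro h
    obtain ⟨i, -, hi⟩ := exists_iterate_regularBase s
    obtain ⟨j, -, hj⟩ := exists_iterate_regularBase t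
    rw [← hi, ← hj, start_iterate, start_iterate, h]

/-! ### Isomorphisms outside given sets of triangles -/

/-- An orientation preserving isomorphism between the complements of two sets of triangles. The
values on the sides of the deleted triangles are irrelevant. -/
structure OuterIso (S T : TriangleGluing) (A : Set S.Face) (B : Set T.Face) where
  /-- The map on sides. -/
  map : S.Side → T.Side
  /-- The inverse map on sides. -/
  inv : T.Side → S.Side
  to_outer : ∀ s, s.1 ∉ A → (map s).1 ∉ B
  inv_outer : ∀ t, t.1 ∉ B → (inv t).1 ∉ A
  inv_to : ∀ s, s.1 ∉ A → inv (map s) = s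
  to_inv : ∀ t, t.1 ∉ B → map (inv t) = t
  to_next : ∀ s, s.1 ∉ A → map (S.next s) = T.next (map s)
  to_mate : ∀ s, s.1 ∉ A → (S.mate s).1 ∉ A → map (S.mate s) = T.mate (map s)
  inv_mate : ∀ t, t.1 ∉ B → (T.mate t).1 ∉ B → inv (T.mate t) = S.mate (inv t)

namespace OuterIso

variable {S T : TriangleGluing} {A : Set S.Face} {B : Set T.Face}

theorem inv_next (e : OuterIso S T A B) (t : T.Side) (ht : t.1 ∉ B) :
    e.inv (T.next t) = S.next (e.inv t) := by
  have h := e.inv_outer t ht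
  rw [← e.inv_to (S.next (e.inv t)) h, e.to_next _ h, e.to_inv t ht]

/-- The inverse isomorphism. -/
def symm (e : OuterIso S T A B) : OuterIso T S B A where
  map := e.inv
  inv := e.map
  to_outer := e.inv_outer
  inv_outer := e.to_outer
  inv_to := e.to_inv
  to_inv := e.inv_to
  to_next := e.inv_next
  to_mate := e.inv_mate
  inv_mate := e.to_mate

theorem to_next_symm (e : OuterIso S T A B) (s : S.Side) (hs : s.1 ∉ A) :
    e.map (S.next.symm s) = T.next.symm (e.map s) := by
  rw [next_symm_apply, next_symm_apply, e.to_next, e.to_next] <;> exact hs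

theorem to_rotate (e : OuterIso S T A B) (s : S.Side) (hs : s.1 ∉ A) (hr : (S.rotate s).1 ∉ A) :
    e.map (S.rotate s) = T.rotate (e.map s) := by
  rw [rotate_apply, e.to_mate _ (by exact hs) hr, e.to_next_symm s hs, rotate_apply]

theorem mate_outer_iff (e : OuterIso S T A B) (s : S.Side) (hs : s.1 ∉ A) :
    (S.mate s).1 ∉ A ↔ (T.mate (e.map s)).1 ∉ B := by
  constructor
  · intro h
    rw [← e.to_mate s hs h]
    exact e.to_outer _ h
  · intro h
    have := e.inv_mate _ (e.to_outer s hs) h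
    rw [e.inv_to s hs] at this
    rw [← this]
    exact e.inv_outer _ h

theorem to_iterate (e : OuterIso S T A B) (s : S.Side) (h : ∀ n, (S.rotate^[n] s).1 ∉ A) (n : ℕ) :
    e.map (S.rotate^[n] s) = T.rotate^[n] (e.map s) := by
  induction n with
  | zero => rfl
  | succ n ih =>
    have h' := h (n + 1)
    rw [Function.iterate_succ_apply'] at h'
    rw [Function.iterate_succ_apply', Function.iterate_succ_apply', ← ih, e.to_rotate _ (h n) h']

/-- Deleting more triangles. -/
def restrict (e : OuterIso S T A B) {B₁ : Set T.Face} (hB : B ⊆ B₁) :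
    OuterIso S T {f | f ∈ A ∨ (e.map (f, 0)).1 ∈ B₁} B₁ := by
  have key : ∀ f, f ∉ A → ∀ i, (e.map (f, i)).1 = (e.map (f, 0)).1 := by
    intro f hf i
    have h1 : e.map (f, 1) = T.next (e.map (f, 0)) := e.to_next (f, 0) hf
    have h2 : e.map (f, 2) = T.next (e.map (f, 1)) := e.to_next (f, 1) hf
    fin_cases i
    · rfl
    · exact (congrArg Prod.fst h1 :)
    · exact ((congrArg Prod.fst h2 :).trans (congrArg Prod.fst h1 :) :)
  have hto : ∀ s : S.Side, s.1 ∉ {f | f ∈ A ∨ (e.map (f, 0)).1 ∈ B₁} → s.1 ∉ A :=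
    fun s hs h => hs (Or.inl h)
  have hinv : ∀ t : T.Side, t.1 ∉ B₁ → t.1 ∉ B := fun t ht h => ht (hB h)
  exact
  { map := e.map
    inv := e.inv
    to_outer := by
      rintro ⟨f, i⟩ hs h
      rw [key f (hto _ hs)] at h
      exact hs (Or.inr h)
    inv_outer := by
      intro t ht h
      have h1 := e.inv_outer t (hinv t ht)
      rcases h with h | h
      · exact h1 h
      · rw [← key _ h1 (e.inv t).2, Prod.mk.eta, e.to_inv t (hinv t ht)] at h
        exact ht h
    inv_to := fun s hs => e.inv_to s (hto s hs)
    to_inv := fun t ht => e.to_inv t (hinv t ht)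
    to_next := fun s hs => e.to_next s (hto s hs)
    to_mate := fun s hs hm => e.to_mate s (hto s hs) (hto _ hm)
    inv_mate := fun t ht hm => e.inv_mate t (hinv t ht) (hinv _ hm) }

/-- Off `A` the map on sides is injective, so only finitely many triangles land in the finite set
`B₁`. -/
theorem finite_restrict (e : OuterIso S T A B) {B₁ : Set T.Face} (hA : A.Finite) (hB : B₁.Finite) :
    {f | f ∈ A ∨ (e.map (f, 0)).1 ∈ B₁}.Finite := by
  have h1 : {f | f ∉ A ∧ (e.map (f, 0)).1 ∈ B₁}.Finite := by
    refine Set.Finite.of_finite_image (f := fun f => e.map (f, 0)) ?_ ?_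
    · refine ((hB.prod (Set.finite_univ (α := Fin 3)))).subset ?_
      rintro _ ⟨f, hf, rfl⟩
      exact ⟨hf.2, trivial⟩
    · intro f hf g hg hfg
      have := congrArg e.inv hfg
      dsimp only at this
      rw [e.inv_to _ (by exact hf.1), e.inv_to _ (by exact hg.1)] at this
      exact congrArg Prod.fst this
  refine (hA.union h1).subset ?_
  intro f hf
  by_cases h : f ∈ A
  · exact Or.inl h
  · exact Or.inr ⟨h, hf.resolve_left h⟩

theorem iterate_six {B : Set regular.Face} (e : OuterIso S regular A B) (s : S.Side)
    (h : ∀ n, (S.rotate^[n] s).1 ∉ A) : S.rotate^[6] s = s := by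
  have h1 := e.to_iterate s h 6
  rw [regular_rotate_six] at h1
  rw [← e.inv_to _ (h 6), h1, e.inv_to s (h 0)]

/-- Forward turns suffice to reach every side at the vertex: if none of them meets `A`, the whole
orbit is carried to the regular tiling and so has period `6`. -/
theorem not_mem_verticesOf_iff {S : TriangleGluing} {A : Set S.Face} {B : Set regular.Face}
    (e : OuterIso S regular A B) (s : S.Side) :
    S.start s ∉ S.verticesOf A ↔ ∀ n, (S.rotate^[n] s).1 ∉ A := by
  constructor
  · intro h n hn
    exact h ⟨_, hn, S.start_iterate s n⟩
  · rintro h ⟨t, ht, hts⟩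
    obtain ⟨j, -, rfl⟩ := S.exists_iterate_of_start_eq (by norm_num) (e.iterate_six s h) hts
    exact h j ht

/-- The identity. -/
def refl (S : TriangleGluing) (A : Set S.Face) : OuterIso S S A A where
  map := id
  inv := id
  to_outer := fun _ h => h
  inv_outer := fun _ h => h
  inv_to := fun _ _ => rfl
  to_inv := fun _ _ => rfl
  to_next := fun _ _ => rfl
  to_mate := fun _ _ _ => rfl
  inv_mate := fun _ _ _ => rfl

theorem mem_verticesOf_iff {S : TriangleGluing} {A : Set S.Face} {B : Set regular.Face}
    (e : OuterIso S regular A B) (s : S.Side) (hs : s.1 ∉ A) :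
    S.start s ∈ S.verticesOf A ↔ regular.start (e.map s) ∈ regular.verticesOf B := by
  rw [← not_iff_not, e.not_mem_verticesOf_iff, (refl regular B).not_mem_verticesOf_iff]
  constructor
  · intro h n
    rw [← e.to_iterate s h]
    exact e.to_outer _ (h n)
  · intro h n
    have := e.symm.to_iterate (e.map s) h n
    change e.inv _ = S.rotate^[n] (e.inv (e.map s)) at this
    rw [e.inv_to s hs] at this
    rw [← this]
    exact e.inv_outer _ (h n)

theorem degree_eq_six {S : TriangleGluing} {A : Set S.Face} {B : Set regular.Face}
    (e : OuterIso S regular A B) {v : S.Vertex} (hv : v ∉ S.verticesOf A) : S.degree v = 6 := by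
  obtain ⟨s, rfl⟩ := S.start_surjective v
  have h := (e.not_mem_verticesOf_iff s).1 hv
  refine S.degree_of_iterate (by norm_num) (e.iterate_six s h) fun i hi j hj hij => ?_
  refine regular_rotate_injective (e.map s) i hi j hj ?_
  rw [← e.to_iterate s h, ← e.to_iterate s h, hij]

theorem exceptional_subset {S : TriangleGluing} {A : Set S.Face} {B : Set regular.Face}
    (e : OuterIso S regular A B) : S.exceptional ⊆ S.verticesOf A := by
  intro v hv
  by_contra h
  exact hv (e.degree_eq_six h)

end OuterIso

/-! ### Reflection of the regular triangulation -/

/-- The reflection of the regular triangulation that exchanges the two lattice coordinates. -/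
def reflectSide (s : regular.Side) : regular.Side := ((s.1.2.1, s.1.1, s.1.2.2), 2 - s.2)

theorem reflectSide_reflectSide (s : regular.Side) : reflectSide (reflectSide s) = s := by
  obtain ⟨⟨m, n, b⟩, i⟩ := s
  simp [reflectSide]

theorem reflectSide_mate (s : regular.Side) :
    reflectSide (regular.mate s) = regular.mate (reflectSide s) := by
  obtain ⟨⟨m, n, b⟩, i⟩ := s
  cases b <;> fin_cases i <;> simp [reflectSide, regular, regularMate]

theorem reflectSide_next_symm (s : regular.Side) :
    reflectSide (regular.next.symm s) = regular.next (reflectSide s) := by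
  obtain ⟨⟨m, n, b⟩, i⟩ := s
  fin_cases i <;> simp [reflectSide, next]

theorem IsoNearInfinity.exists_outerIso {T : TriangleGluing} (h : IsoNearInfinity T regular)
    (hne : Nonempty T.Side) :
    ∃ (A : Set T.Face) (B : Set regular.Face), A.Finite ∧ B.Finite ∧
      Nonempty (OuterIso T regular A B) := by
  classical
  obtain ⟨A, B, hA, hB, φ, hnext, hmate⟩ := h
  have s₀ := hne.some
  -- The values on deleted triangles are arbitrary; no condition of `OuterIso` concerns them.
  set to₀ : T.Side → regular.Side := fun s => if h : s.1 ∉ A then (φ ⟨s, h⟩).1 else ((0, 0, true), 0)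
  set inv₀ : regular.Side → T.Side := fun s => if h : s.1 ∉ B then (φ.symm ⟨s, h⟩).1 else s₀
  have hto : ∀ s (h : s.1 ∉ A), to₀ s = (φ ⟨s, h⟩).1 := fun s h => dif_pos h
  have hinv : ∀ s (h : s.1 ∉ B), inv₀ s = (φ.symm ⟨s, h⟩).1 := fun s h => dif_pos h
  have hto_outer : ∀ s, s.1 ∉ A → (to₀ s).1 ∉ B := fun s h => by rw [hto s h]; exact (φ ⟨s, h⟩).2
  have hinv_outer : ∀ s, s.1 ∉ B → (inv₀ s).1 ∉ A := fun s h => by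
    rw [hinv s h]; exact (φ.symm ⟨s, h⟩).2
  have hinv_to : ∀ s, s.1 ∉ A → inv₀ (to₀ s) = s := fun s h => by
    rw [hinv _ (hto_outer s h)]; simp [hto s h]
  have hto_inv : ∀ s, s.1 ∉ B → to₀ (inv₀ s) = s := fun s h => by
    rw [hto _ (hinv_outer s h)]; simp [hinv s h]
  have hto_mate : ∀ s, s.1 ∉ A → (T.mate s).1 ∉ A → to₀ (T.mate s) = regular.mate (to₀ s) := by
    intro s h h'
    rw [hto s h, hto _ h']
    exact (hmate ⟨s, h⟩ ⟨_, h'⟩).1 rfl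
  have hinv_mate : ∀ t, t.1 ∉ B → (regular.mate t).1 ∉ B →
      inv₀ (regular.mate t) = T.mate (inv₀ t) := by
    intro t h h'
    rw [hinv t h, hinv _ h']
    exact (hmate _ _).2 (by simp)
  rcases hnext with hnext | hnext
  · refine ⟨A, B, hA, hB, ⟨⟨to₀, inv₀, hto_outer, hinv_outer, hinv_to, hto_inv, ?_, hto_mate,
      hinv_mate⟩⟩⟩
    intro s h
    rw [hto s h, hto (T.next s) h]
    exact hnext ⟨s, h⟩ ⟨T.next s, h⟩ rfl
  -- An order-reversing isomorphism becomes order-preserving after composition with the reflection;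
  -- `B` is replaced by its mirror image.
  · set ρ : regular.Face → regular.Face := fun f => (f.2.1, f.1, f.2.2)
    have hρ : ∀ s, (reflectSide s).1 = ρ s.1 := fun s => rfl
    have hρρ : ∀ f, ρ (ρ f) = f := fun f => rfl
    refine ⟨A, ρ ⁻¹' B, hA, hB.preimage (Function.LeftInverse.injective hρρ).injOn,
      ⟨⟨fun s => reflectSide (to₀ s), fun t => inv₀ (reflectSide t), ?_, ?_, ?_, ?_, ?_, ?_, ?_⟩⟩⟩
    · intro s h
      rw [hρ, Set.mem_preimage, hρρ]
      exact hto_outer s h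
    · intro t h
      exact hinv_outer _ h
    · intro s h
      rw [reflectSide_reflectSide, hinv_to s h]
    · intro t h
      rw [hto_inv _ (by exact h), reflectSide_reflectSide]
    · intro s h
      rw [← reflectSide_next_symm, hto s h, hto (T.next s) h]
      exact congrArg _ (hnext ⟨s, h⟩ ⟨T.next s, h⟩ rfl)
    · intro s h h'
      rw [hto_mate s h h', reflectSide_mate]
    · intro t h h'
      rw [reflectSide_mate]
      refine hinv_mate _ h ?_
      rw [← reflectSide_mate]
      exact h'


/-! ### The collar of a square in the regular triangulation -/

/-- The triangles of the regular triangulation in the rhombus of lattice points with coordinates of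
absolute value at most `N`. -/
def box (N : ℤ) : Set regular.Face := {f | (-N ≤ f.1 ∧ f.1 < N) ∧ -N ≤ f.2.1 ∧ f.2.1 < N}

theorem mem_box {N m n : ℤ} {b : Bool} :
    ((m, n, b) : ℤ × ℤ × Bool) ∈ box N ↔ (-N ≤ m ∧ m < N) ∧ -N ≤ n ∧ n < N := Iff.rfl

/-- The starting point of a side of the regular triangulation. -/
def corner (s : regular.Side) : ℤ × ℤ := regularCorner s.1 s.2

theorem corner_rotate (s : regular.Side) : corner (regular.rotate s) = corner s :=
  regularCorner_rotate s

theorem corner_next (s : regular.Side) : corner (regular.next s) = corner (regular.mate s) :=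
  (regularCorner_mate s).1.symm

/-- The nearest point to `x` in `[-N, N]`. -/
def clampInt (N x : ℤ) : ℤ := max (-N) (min N x)

/-- The retraction of the lattice onto a rhombus. -/
def clamp (N : ℤ) (x : ℤ × ℤ) : ℤ × ℤ := (clampInt N x.1, clampInt N x.2)

/-- The antisymmetric function on pairs of lattice points with the given values on horizontal and
vertical edges, and zero on all other pairs. -/
def axisValue (H V : ℤ × ℤ → ℤ) (x y : ℤ × ℤ) : ℤ :=
  if y = (x.1 + 1, x.2) then H x else if x = (y.1 + 1, y.2) then -H y else
  if y = (x.1, x.2 + 1) then V x else if x = (y.1, y.2 + 1) then -V y else 0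

section axisValue

variable (H V : ℤ × ℤ → ℤ) (x y : ℤ)

@[simp] theorem axisValue_self (x : ℤ × ℤ) : axisValue H V x x = 0 := by
  simp [axisValue, Prod.ext_iff]

@[simp] theorem axisValue_right : axisValue H V (x, y) (x + 1, y) = H (x, y) := by
  simp [axisValue]

@[simp] theorem axisValue_left : axisValue H V (x + 1, y) (x, y) = -H (x, y) := by
  have : x ≠ x + 1 + 1 := by omega
  simp [axisValue, this]

@[simp] theorem axisValue_up : axisValue H V (x, y) (x, y + 1) = V (x, y) := by
  simp [axisValue]

@[simp] theorem axisValue_down : axisValue H V (x, y + 1) (x, y) = -V (x, y) := by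
  have : y ≠ y + 1 + 1 := by omega
  simp [axisValue, this]

theorem axisValue_swap (x y : ℤ × ℤ) : axisValue H V y x = -axisValue H V x y := by
  obtain ⟨a, b⟩ := x
  obtain ⟨a', b'⟩ := y
  simp only [axisValue, Prod.mk.injEq]
  split_ifs <;> omega

end axisValue

theorem clampInt_cases {N : ℤ} (hN : 1 ≤ N) (m : ℤ) :
    (-N ≤ m ∧ m < N ∧ clampInt N m = m ∧ clampInt N (m + 1) = m + 1) ∨
      (m < -N ∧ clampInt N m = -N ∧ clampInt N (m + 1) = -N) ∨
      (N ≤ m ∧ clampInt N m = N ∧ clampInt N (m + 1) = N) := by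
  unfold clampInt
  omega

theorem clampInt_of_mem {N x : ℤ} (h : -N ≤ x) (h' : x ≤ N) : clampInt N x = x := by
  unfold clampInt
  omega

/-- The retraction flattens every triangle outside the rhombus to a boundary edge or a point. One
side contributes zero and the other two cancel, so the pulled-back cochain is closed there, whatever
`H` and `V` are. Diagonals flatten too, which is why axis-parallel edges suffice. -/
theorem axisValue_clamp_sum {N : ℤ} (hN : 1 ≤ N) (H V : ℤ × ℤ → ℤ) {f : ℤ × ℤ × Bool}
    (hf : f ∉ box N) :
    axisValue H V (clamp N (regularCorner f 0)) (clamp N (regularCorner f 1)) +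
      axisValue H V (clamp N (regularCorner f 1)) (clamp N (regularCorner f 2)) +
      axisValue H V (clamp N (regularCorner f 2)) (clamp N (regularCorner f 0)) = 0 := by
  obtain ⟨m, n, b⟩ := f
  rw [mem_box] at hf
  cases b <;>
  rcases clampInt_cases hN m with ⟨h1, h2, h3, h4⟩ | ⟨h1, h3, h4⟩ | ⟨h1, h3, h4⟩ <;>
  rcases clampInt_cases hN n with ⟨h5, h6, h7, h8⟩ | ⟨h5, h7, h8⟩ | ⟨h5, h7, h8⟩ <;>
  first
  | (exfalso; omega)
  | simp [regularCorner, clamp, h3, h4, h7, h8]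

/-- This margin of one layer is the reason for requiring `B ⊆ box (N - 1)` below: the isomorphism is
then defined on both sides of the boundary of `box N`. -/
theorem mate_mem_box {N : ℤ} {t : (ℤ × ℤ × Bool) × Fin 3} (ht : t.1 ∈ box (N - 1)) :
    (regular.mate t).1 ∈ box N := by
  obtain ⟨⟨m, n, b⟩, i⟩ := t
  rw [mem_box] at ht
  change (-N ≤ (regularMate ((m, n, b), i)).1.1 ∧ (regularMate ((m, n, b), i)).1.1 < N) ∧
    -N ≤ (regularMate ((m, n, b), i)).1.2.1 ∧ (regularMate ((m, n, b), i)).1.2.1 < N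
  cases b <;> fin_cases i <;> simp only [regularMate] <;> omega

theorem corner_of_mem_box {N : ℤ} {t : (ℤ × ℤ × Bool) × Fin 3} (ht : t.1 ∈ box N) :
    (-N ≤ (corner t).1 ∧ (corner t).1 ≤ N) ∧ -N ≤ (corner t).2 ∧ (corner t).2 ≤ N := by
  obtain ⟨⟨m, n, b⟩, i⟩ := t
  rw [mem_box] at ht
  cases b <;> fin_cases i <;> simp only [corner, regularCorner] <;> omega

/-- The lattice points on the boundary of a rhombus. -/
def boxBoundary (N : ℤ) : Set (ℤ × ℤ) :=
  {x | ((-N ≤ x.1 ∧ x.1 ≤ N) ∧ -N ≤ x.2 ∧ x.2 ≤ N) ∧ (x.1 = N ∨ x.1 = -N ∨ x.2 = N ∨ x.2 = -N)}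

theorem not_mem_box_of_corner {N : ℤ} {t : regular.Side} (ht : corner t ∈ boxBoundary N) :
    t.1 ∉ box (N - 1) := by
  intro h
  have := corner_of_mem_box h
  obtain ⟨-, h1⟩ := ht
  omega

theorem clamp_corner_mem {N : ℤ} (hN : 1 ≤ N) {t : (ℤ × ℤ × Bool) × Fin 3} (ht : t.1 ∉ box N) :
    clamp N (corner t) ∈ boxBoundary N := by
  obtain ⟨⟨m, n, b⟩, i⟩ := t
  rw [mem_box] at ht
  cases b <;> fin_cases i <;>
    simp only [corner, regularCorner, clamp, clampInt, boxBoundary, Set.mem_ofPred_eq] <;> omega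

theorem clamp_eq_self {N : ℤ} {x : ℤ × ℤ}
    (hx : (-N ≤ x.1 ∧ x.1 ≤ N) ∧ -N ≤ x.2 ∧ x.2 ≤ N) : clamp N x = x :=
  Prod.ext (clampInt_of_mem hx.1.1 hx.1.2) (clampInt_of_mem hx.2.1 hx.2.2)

/-- Two lattice points are joined by an edge of a rhombus. -/
def BoxAdj (N : ℤ) (x y : ℤ × ℤ) : Prop :=
  ∃ t : regular.Side, corner t = x ∧ corner (regular.mate t) = y ∧ t ∈ regular.sidesOf (box N)

theorem BoxAdj.symm {N : ℤ} {x y : ℤ × ℤ} (h : BoxAdj N x y) : BoxAdj N y x := by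
  obtain ⟨t, h1, h2, h3⟩ := h
  exact ⟨regular.mate t, h2, by rw [regular.mate_mate]; exact h1, regular.mate_mem_sidesOf.2 h3⟩

theorem boxAdj_right {N : ℤ} (hN : 1 ≤ N) {x y : ℤ} (hx : -N ≤ x ∧ x < N) (hy : -N ≤ y ∧ y ≤ N) :
    BoxAdj N (x, y) (x + 1, y) := by
  refine ⟨((x, y, true), 0), rfl, by simp [corner, regular, regularMate, regularCorner], ?_⟩
  change (x, y, true) ∈ box N ∨ (x, y - 1, false) ∈ box N
  rw [mem_box, mem_box]
  omega

theorem boxAdj_up {N : ℤ} (hN : 1 ≤ N) {x y : ℤ} (hx : -N ≤ x ∧ x ≤ N) (hy : -N ≤ y ∧ y < N) :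
    BoxAdj N (x, y) (x, y + 1) := by
  refine BoxAdj.symm
    ⟨((x, y, true), 2), rfl, by simp [corner, regular, regularMate, regularCorner], ?_⟩
  change (x, y, true) ∈ box N ∨ (x - 1, y, false) ∈ box N
  rw [mem_box, mem_box]
  omega

theorem clamp_eq_or_boxAdj {N : ℤ} (hN : 1 ≤ N) {t : (ℤ × ℤ × Bool) × Fin 3} (ht : t.1 ∉ box N) :
    clamp N (corner t) = clamp N (corner (regular.next t)) ∨
      BoxAdj N (clamp N (corner t)) (clamp N (corner (regular.next t))) := by
  obtain ⟨⟨m, n, b⟩, i⟩ := t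
  rw [mem_box] at ht
  have hm := @boxAdj_right N hN m
  have hn := @boxAdj_up N hN
  cases b <;> fin_cases i <;> simp only [corner, next, Equiv.coe_fn_mk] <;>
  rcases clampInt_cases hN m with ⟨h1, h2, h3, h4⟩ | ⟨h1, h3, h4⟩ | ⟨h1, h3, h4⟩ <;>
  rcases clampInt_cases hN n with ⟨h5, h6, h7, h8⟩ | ⟨h5, h7, h8⟩ | ⟨h5, h7, h8⟩ <;>
  first
  | (exfalso; omega)
  | (simp [regularCorner, clamp, h3, h4, h7, h8]; done)
  | (right; simp [regularCorner, clamp, h3, h4, h7, h8]; apply hm <;> omega)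
  | (right; simp [regularCorner, clamp, h3, h4, h7, h8]; apply hn <;> omega)
  | (right; apply BoxAdj.symm; simp [regularCorner, clamp, h3, h4, h7, h8]; apply hm <;> omega)
  | (right; apply BoxAdj.symm; simp [regularCorner, clamp, h3, h4, h7, h8]; apply hn <;> omega)

/-! ### The core of the triangulation and its cocycles -/

namespace OuterIso

variable {T : TriangleGluing} {A : Set T.Face} {B : Set regular.Face} (e : OuterIso T regular A B)

/-- The triangles not outside the rhombus of size `N`. -/
def core (N : ℤ) : Set T.Face := {f | f ∈ A ∨ (e.map (f, 0)).1 ∈ box N}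

theorem subset_box {N : ℤ} (hB : B ⊆ box (N - 1)) : B ⊆ box N := by
  intro f hf
  have := hB hf
  simp only [box, Set.mem_ofPred_eq] at this ⊢
  omega

/-- The isomorphism outside a rhombus. -/
def coreIso {N : ℤ} (hB : B ⊆ box (N - 1)) : OuterIso T regular (e.core N) (box N) :=
  e.restrict (subset_box hB)

theorem not_mem_of_not_mem_core {N : ℤ} {f : T.Face} (hf : f ∉ e.core N) : f ∉ A :=
  fun h => hf (Or.inl h)

theorem inv_mem_core {N : ℤ} (hB : B ⊆ box (N - 1)) {t : regular.Side} (ht : t.1 ∉ B)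
    (htN : t.1 ∈ box N) : (e.inv t).1 ∈ e.core N := by
  by_contra h
  have := (e.coreIso hB).to_outer _ h
  change (e.map (e.inv t)).1 ∉ _ at this
  rw [e.to_inv t ht] at this
  exact this htN

theorem mate_map_mem_box {N : ℤ} (hB : B ⊆ box (N - 1)) {s : T.Side} (hs : s.1 ∉ e.core N)
    (hm : (T.mate s).1 ∈ e.core N) : (regular.mate (e.map s)).1 ∈ box N := by
  by_contra h
  exact ((e.coreIso hB).mate_outer_iff s hs).2 h hm

theorem mate_not_mem {N : ℤ} (hB : B ⊆ box (N - 1)) {s : T.Side} (hs : s.1 ∉ e.core N) :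
    (T.mate s).1 ∉ A := by
  rw [e.mate_outer_iff s (e.not_mem_of_not_mem_core hs)]
  intro h
  have h1 := mate_mem_box (hB h)
  rw [regular.mate_mate] at h1
  exact (e.coreIso hB).to_outer s hs h1

theorem map_mate_of_boundary {N : ℤ} (hB : B ⊆ box (N - 1)) {s : T.Side} (hs : s.1 ∉ e.core N) :
    e.map (T.mate s) = regular.mate (e.map s) :=
  e.to_mate s (e.not_mem_of_not_mem_core hs) (e.mate_not_mem hB hs)

end OuterIso

namespace OuterIso

variable {T : TriangleGluing} {A : Set T.Face} {B : Set regular.Face} (e : OuterIso T regular A B)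

/-- The vertex of the glued surface that corresponds to a lattice point. -/
def vertexAt (x : ℤ × ℤ) : T.Vertex := T.start (e.inv (regularBase x))

theorem start_inv_of_boundary {N : ℤ} (hB : B ⊆ box (N - 1)) {t : regular.Side}
    (ht : corner t ∈ boxBoundary N) : T.start (e.inv t) = e.vertexAt (corner t) := by
  obtain ⟨j, -, hj⟩ := exists_iterate_regularBase t
  have h : ∀ n, (regular.rotate^[n] (regularBase (corner t))).1 ∉ B := by
    intro n hn
    refine not_mem_box_of_corner ?_ (hB hn)
    have h1 := regularCorner_iterate (regularBase (corner t)) n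
    change corner _ = _ at h1
    rw [h1]
    exact ht
  have h1 := e.symm.to_iterate _ h j
  change e.inv (regular.rotate^[j] (regularBase (regularCorner t.1 t.2))) = _ at h1
  rw [hj] at h1
  rw [h1, start_iterate]
  rfl

theorem start_eq_vertexAt {N : ℤ} (hB : B ⊆ box (N - 1)) {s : T.Side} (hs : s.1 ∉ A)
    (h : corner (e.map s) ∈ boxBoundary N) : T.start s = e.vertexAt (corner (e.map s)) := by
  rw [← e.start_inv_of_boundary hB h, e.inv_to s hs]

/-- The vertices of the core are connected by edges of the core. -/
theorem core_vertex_induction (hT : T.IsPlane) {N : ℤ} (hN : 1 ≤ N) (hB : B ⊆ box (N - 1))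
    {Q : T.Vertex → Prop}
    (hQ : ∀ s ∈ T.sidesOf (e.core N), Q (T.start s) → Q (T.start (T.mate s)))
    {v₀ : T.Vertex} (hv₀ : v₀ ∈ T.verticesOf (e.core N)) (h₀ : Q v₀)
    {v : T.Vertex} (hv : v ∈ T.verticesOf (e.core N)) : Q v := by
  classical
  -- `Q` is spread to all sides by retracting the exterior to the boundary of the core, so that
  -- connectedness of the whole plane yields connectedness of the core.
  set P : T.Side → Prop := fun s =>
    if s.1 ∈ e.core N then Q (T.start s) else Q (e.vertexAt (clamp N (corner (e.map s)))) with hP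
  have hin : ∀ s : T.Side, s.1 ∈ e.core N → (P s ↔ Q (T.start s)) := fun s h => by simp [hP, h]
  have hout : ∀ s : T.Side, s.1 ∉ e.core N →
      (P s ↔ Q (e.vertexAt (clamp N (corner (e.map s))))) := fun s h => by simp [hP, h]
  have hnext : ∀ s, P s → P (T.next s) := by
    intro s h
    by_cases hs : s.1 ∈ e.core N
    · rw [hin s hs] at h
      rw [hin _ (by exact hs), start_next]
      exact hQ s (Or.inl hs) h
    · rw [hout s hs] at h
      rw [hout _ (by exact hs), e.to_next s (e.not_mem_of_not_mem_core hs)]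
      have hbox := (e.coreIso hB).to_outer s hs
      change (e.map s).1 ∉ box N at hbox
      have hx := clamp_corner_mem hN hbox
      have hy := clamp_corner_mem hN (t := regular.next (e.map s)) hbox
      rcases clamp_eq_or_boxAdj hN hbox with heq | ⟨t, htx, hty, ht⟩
      · rwa [← heq]
      · rw [← htx] at h hx
        rw [← hty] at hy ⊢
        have h1 : t.1 ∉ B := fun h => not_mem_box_of_corner hx (hB h)
        have h2 : (regular.mate t).1 ∉ B := fun h => not_mem_box_of_corner hy (hB h)
        rw [← e.start_inv_of_boundary hB hx] at h
        rw [← e.start_inv_of_boundary hB hy, e.inv_mate t h1 h2]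
        refine hQ _ ?_ h
        rcases ht with ht | ht
        · exact Or.inl (e.inv_mem_core hB h1 ht)
        · right
          rw [← e.inv_mate t h1 h2]
          exact e.inv_mem_core hB h2 ht
  have hrotate : ∀ s, P s → P (T.rotate s) := by
    intro s h
    by_cases hs : s.1 ∈ e.core N <;> by_cases hr : (T.rotate s).1 ∈ e.core N
    · rw [hin s hs] at h
      rw [hin _ hr, start_rotate]
      exact h
    · rw [hin s hs] at h
      rw [hout _ hr]
      -- Here the turn leaves the core. By the margin `s` is still outside `A`, so its image makes
      -- sense; its corner lies on the boundary of the rhombus, where `clamp` is the identity.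
      have hm : (T.mate (T.rotate s)).1 ∈ e.core N := by
        rw [rotate_apply, T.mate_mate]; exact hs
      have hmA := e.mate_not_mem hB hr
      have hmap := e.map_mate_of_boundary hB hr
      have hmb := e.mate_map_mem_box hB hr hm
      have hbox := (e.coreIso hB).to_outer _ hr
      change (e.map (T.rotate s)).1 ∉ box N at hbox
      have hsA : s.1 ∉ A := by
        rw [rotate_apply, T.mate_mate] at hmA; exact hmA
      have hrA := e.not_mem_of_not_mem_core hr
      have hrs := e.to_rotate s hsA hrA
      have hsbox : (e.map s).1 ∈ box N := by
        rw [hrs, rotate_apply, regular.mate_mate] at hmb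
        exact hmb
      have hcor : corner (e.map (T.rotate s)) = corner (e.map s) := by rw [hrs, corner_rotate]
      have hx := clamp_corner_mem hN hbox
      have hc := clamp_eq_self (corner_of_mem_box hsbox)
      rw [hcor, hc] at hx ⊢
      rw [← e.start_eq_vertexAt hB hsA hx]
      exact h
    · rw [hout s hs] at h
      rw [hin _ hr, start_rotate]
      have hp : (T.next.symm s).1 ∉ e.core N := hs
      have hsA := e.not_mem_of_not_mem_core hs
      have hrs := e.to_rotate s hsA (e.mate_not_mem hB hp)
      have hmb := e.mate_map_mem_box hB hp hr
      rw [← e.map_mate_of_boundary hB hp, ← rotate_apply, hrs] at hmb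
      have hbox := (e.coreIso hB).to_outer s hs
      change (e.map s).1 ∉ box N at hbox
      have hx := clamp_corner_mem hN hbox
      have hc := clamp_eq_self (corner_of_mem_box hmb)
      rw [corner_rotate] at hc
      rw [hc] at hx h
      rw [e.start_eq_vertexAt hB hsA hx]
      exact h
    · rw [hout s hs] at h
      rw [hout _ hr, e.to_rotate s (e.not_mem_of_not_mem_core hs) (e.not_mem_of_not_mem_core hr),
        corner_rotate]
      exact h
  obtain ⟨s₀, hs₀, rfl⟩ := hv₀
  obtain ⟨s, hs, rfl⟩ := hv
  rw [← hin s hs]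
  refine hT.side_induction hnext (fun s h => ?_) ((hin s₀ hs₀).2 h₀) s
  rw [← rotate_next]
  exact hrotate _ (hnext _ h)

/-- On boundary edges the retraction is the identity, so the pulled-back cochain restricts to `c`.
The sign in `V` appears because side `2` of an upward triangle runs downwards. -/
theorem boundary_value {N : ℤ} {c : T.Side → ℤ}
    (hanti : ∀ s, c (T.mate s) = -c s) (hB : B ⊆ box (N - 1)) {t : (ℤ × ℤ × Bool) × Fin 3}
    (ht : t.1 ∉ box N) (hm : (regular.mate t).1 ∈ box N) :
    c (e.inv t) = axisValue (fun x => c (e.inv ((x.1, x.2, true), 0)))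
      (fun x => -c (e.inv ((x.1, x.2, true), 2))) (clamp N (corner t))
      (clamp N (corner (regular.next t))) := by
  have htB : t.1 ∉ B := fun h => ht (subset_box hB h)
  have hmB : (regular.mate t).1 ∉ B := by
    intro h
    have h1 := mate_mem_box (hB h)
    have h2 : regular.mate (regular.mate t) = t := regular.mate_mate t
    rw [h2] at h1
    exact ht h1
  have hinv := congrArg c (e.inv_mate t htB hmB)
  rw [hanti] at hinv
  obtain ⟨⟨m, n, b⟩, i⟩ := t
  rw [mem_box] at ht
  change (-N ≤ (regularMate ((m, n, b), i)).1.1 ∧ (regularMate ((m, n, b), i)).1.1 < N) ∧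
    -N ≤ (regularMate ((m, n, b), i)).1.2.1 ∧ (regularMate ((m, n, b), i)).1.2.1 < N at hm
  change c (e.inv (regularMate ((m, n, b), i))) = _ at hinv
  have hcl := @clampInt_of_mem N
  cases b <;> fin_cases i <;> simp only [regularMate] at hm hinv
  · change c _ = axisValue _ _ (clampInt N (m + 1), clampInt N (n + 1))
      (clampInt N m, clampInt N (n + 1))
    rw [hcl (x := m) (by omega) (by omega), hcl (x := m + 1) (by omega) (by omega),
      hcl (x := n + 1) (by omega) (by omega), axisValue_left]
    exact (neg_eq_iff_eq_neg.2 hinv).symm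
  · exact absurd hm ht
  · change c _ = axisValue _ _ (clampInt N (m + 1), clampInt N n)
      (clampInt N (m + 1), clampInt N (n + 1))
    rw [hcl (x := n) (by omega) (by omega), hcl (x := m + 1) (by omega) (by omega),
      hcl (x := n + 1) (by omega) (by omega), axisValue_up]
    exact (neg_eq_iff_eq_neg.2 hinv).symm
  · change c _ = axisValue _ _ (clampInt N m, clampInt N n)
      (clampInt N (m + 1), clampInt N n)
    rw [hcl (x := m) (by omega) (by omega), hcl (x := m + 1) (by omega) (by omega),
      hcl (x := n) (by omega) (by omega), axisValue_right]
    rfl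
  · exact absurd hm ht
  · change c _ = axisValue _ _ (clampInt N m, clampInt N (n + 1))
      (clampInt N m, clampInt N n)
    rw [hcl (x := m) (by omega) (by omega), hcl (x := n) (by omega) (by omega),
      hcl (x := n + 1) (by omega) (by omega), axisValue_down]
    exact (neg_neg _).symm

/-- A cocycle on the core extends to a cocycle on the whole surface. -/
theorem exists_cocycle_extension {N : ℤ} (hN : 1 ≤ N) (hB : B ⊆ box (N - 1)) {c : T.Side → ℤ}
    (hanti : ∀ s, c (T.mate s) = -c s)
    (hclosed : ∀ f ∈ e.core N, c (f, 0) + c (f, 1) + c (f, 2) = 0) :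
    ∃ c' : T.Side → ℤ, (∀ s, c' (T.mate s) = -c' s) ∧
      (∀ f, c' (f, 0) + c' (f, 1) + c' (f, 2) = 0) ∧ ∀ s ∈ T.sidesOf (e.core N), c' s = c s := by
  classical
  set a : regular.Side → ℤ := fun t => axisValue (fun x => c (e.inv ((x.1, x.2, true), 0)))
    (fun x => -c (e.inv ((x.1, x.2, true), 2))) (clamp N (corner t))
    (clamp N (corner (regular.next t))) with ha
  set c' : T.Side → ℤ := fun s => if s ∈ T.sidesOf (e.core N) then c s else a (e.map s) with hc'
  have hin : ∀ s ∈ T.sidesOf (e.core N), c' s = c s := fun s hs => if_pos hs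
  -- On boundary sides both branches of the definition of `c'` agree, so one formula covers every
  -- exterior triangle.
  have hout : ∀ s, s.1 ∉ e.core N → c' s = a (e.map s) := by
    intro s hs
    by_cases h : s ∈ T.sidesOf (e.core N)
    · rw [hin s h]
      have hm := h.resolve_left hs
      have h1 := e.boundary_value hanti hB ((e.coreIso hB).to_outer s hs)
        (e.mate_map_mem_box hB hs hm)
      change c (e.inv (e.map s)) = a (e.map s) at h1
      rwa [e.inv_to s (e.not_mem_of_not_mem_core hs)] at h1
    · exact if_neg h
  refine ⟨c', fun s => ?_, fun f => ?_, hin⟩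
  · by_cases h : s ∈ T.sidesOf (e.core N)
    · rw [hin s h, hin _ (T.mate_mem_sidesOf.2 h), hanti]
    · have h1 : s.1 ∉ e.core N := fun h' => h (Or.inl h')
      have h2 : (T.mate s).1 ∉ e.core N := fun h' => h (Or.inr h')
      rw [hout s h1, hout _ h2, e.map_mate_of_boundary hB h1]
      simp only [ha]
      rw [corner_next, corner_next, regular.mate_mate]
      exact axisValue_swap _ _ _ _
  · by_cases hf : f ∈ e.core N
    · rw [hin _ (Or.inl hf), hin _ (Or.inl hf), hin _ (Or.inl hf), hclosed f hf]
    · have hA := e.not_mem_of_not_mem_core hf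
      have h1 : e.map (f, 1) = regular.next (e.map (f, 0)) := e.to_next (f, 0) hA
      have h2 : e.map (f, 2) = regular.next (e.map (f, 1)) := e.to_next (f, 1) hA
      have hbox := (e.coreIso hB).to_outer (f, 0) hf
      change (e.map (f, 0)).1 ∉ box N at hbox
      rw [hout _ (by exact hf), hout _ (by exact hf), hout _ (by exact hf), h2, h1]
      generalize e.map (f, 0) = t at hbox ⊢
      -- The image of side `0` may be any side of the image triangle; hence the cyclic shifts of
      -- this sum below.
      have h : a (t.1, 0) + a (t.1, 1) + a (t.1, 2) = 0 := axisValue_clamp_sum hN _ _ hbox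
      obtain ⟨g, i⟩ := t
      fin_cases i
      · exact h
      · have h1 : regular.next (g, 1) = (g, 2) := rfl
        have h2 : regular.next (g, 2) = (g, 0) := rfl
        change a (g, 1) + a (regular.next (g, 1)) + a (regular.next (regular.next (g, 1))) = 0
        rw [h1, h2]
        exact (add_rotate (a (g, 0)) (a (g, 1)) (a (g, 2))).symm.trans h
      · exact (add_rotate (a (g, 2)) (a (g, 0)) (a (g, 1))).trans h

/-- A cocycle on the core is a coboundary. -/
theorem exists_core_potential (hT : T.IsPlane) {N : ℤ} (hN : 1 ≤ N) (hB : B ⊆ box (N - 1))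
    {c : T.Side → ℤ} (hanti : ∀ s, c (T.mate s) = -c s)
    (hclosed : ∀ f ∈ e.core N, c (f, 0) + c (f, 1) + c (f, 2) = 0) :
    ∃ ψ : T.Vertex → ℤ, ∀ s ∈ T.sidesOf (e.core N),
      c s = ψ (T.start (T.mate s)) - ψ (T.start s) := by
  obtain ⟨c', h1, h2, h3⟩ := e.exists_cocycle_extension hN hB hanti hclosed
  obtain ⟨ψ, h4, h5⟩ := hT.exists_potential c' h1 h2
  -- The potential is invariant under turning about the start, hence a function of vertices.
  have h6 : ∀ s, ψ (T.rotate s) = ψ s := by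
    intro s
    rw [rotate_apply, h5, Equiv.apply_symm_apply]
  have h7 : ∀ s t, T.rotate.SameCycle s t → ψ s = ψ t := by
    rintro s _ ⟨n, rfl⟩
    induction n using Int.induction_on with
    | zero => rfl
    | succ n ih => rw [add_comm, zpow_add, zpow_one, Equiv.Perm.mul_apply, h6, ih]
    | pred n ih =>
      rw [ih, ← h6 ((T.rotate ^ (-(n : ℤ) - 1)) s), ← Equiv.Perm.mul_apply, ← zpow_one_add]
      congr 3
      ring
  refine ⟨Quotient.lift ψ h7, fun s hs => ?_⟩
  change c s = ψ (T.mate s) - ψ s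
  rw [← h3 s hs, h5, h4]
  ring

end OuterIso

/-! ### Counting -/

/-- Representatives for the edges of the triangles in `K`. -/
def edgesOf (T : TriangleGluing) (K : Set T.Face) : Set T.Side :=
  {s | s ∈ T.sidesOf K ∧ WellOrderingRel s (T.mate s)}

section edges

variable {T : TriangleGluing} {K : Set T.Face}

theorem mate_not_mem_edgesOf {s : T.Side} (hs : s ∈ T.edgesOf K) : T.mate s ∉ T.edgesOf K := by
  rintro ⟨-, h⟩
  rw [T.mate_mate] at h
  exact asymm h hs.2

theorem mem_edgesOf_or {s : T.Side} (hs : s ∈ T.sidesOf K) :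
    s ∈ T.edgesOf K ∨ T.mate s ∈ T.edgesOf K := by
  rcases trichotomous_of WellOrderingRel s (T.mate s) with h | h | h
  · exact Or.inl ⟨hs, h⟩
  · exact absurd h.symm (T.mate_ne s)
  · refine Or.inr ⟨T.mate_mem_sidesOf.2 hs, ?_⟩
    rwa [T.mate_mate]

/-- The sides outside `K` whose partners belong to triangles of `K`. -/
def boundarySides (T : TriangleGluing) (K : Set T.Face) : Set T.Side :=
  {s | s.1 ∉ K ∧ (T.mate s).1 ∈ K}

theorem finite_sides (hK : K.Finite) : {s : T.Side | s.1 ∈ K}.Finite :=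
  (hK.prod (Set.finite_univ (α := Fin 3))).subset fun _ hs => ⟨hs, trivial⟩

theorem ncard_sides : {s : T.Side | s.1 ∈ K}.ncard = 3 * K.ncard := by
  have : {s : T.Side | s.1 ∈ K} = K ×ˢ (Set.univ : Set (Fin 3)) := by
    ext s; simp
  rw [this, Set.ncard_prod, Set.ncard_univ, Nat.card_fin, mul_comm]

theorem finite_boundarySides (hK : K.Finite) : (T.boundarySides K).Finite :=
  ((finite_sides hK).preimage (f := T.mate) T.mate_injective.injOn).subset fun _ hs => hs.2

theorem finite_sidesOf (hK : K.Finite) : (T.sidesOf K).Finite :=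
  (finite_sides hK).union ((finite_sides hK).preimage (f := T.mate) T.mate_injective.injOn)

theorem finite_edgesOf (hK : K.Finite) : (T.edgesOf K).Finite :=
  (finite_sidesOf hK).subset fun _ hs => hs.1

theorem finite_verticesOf (hK : K.Finite) : (T.verticesOf K).Finite :=
  (finite_sides hK).image _

/-- Both sides count the sides in `K` together with their partners: each edge gives two of them, and
those not in `K` are the boundary sides. -/
theorem two_mul_ncard_edgesOf (hK : K.Finite) :
    2 * (T.edgesOf K).ncard = 3 * K.ncard + (T.boundarySides K).ncard := by
  have h1 : T.sidesOf K = T.edgesOf K ∪ T.mate '' T.edgesOf K := by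
    ext s
    constructor
    · intro hs
      rcases mem_edgesOf_or hs with h | h
      · exact Or.inl h
      · exact Or.inr ⟨_, h, T.mate_mate s⟩
    · rintro (h | ⟨t, h, rfl⟩)
      · exact h.1
      · exact T.mate_mem_sidesOf.2 h.1
  have h2 : T.sidesOf K = {s | s.1 ∈ K} ∪ T.boundarySides K := by
    ext s
    by_cases h : s.1 ∈ K <;> simp [sidesOf, boundarySides, h]
  have h3 : (T.sidesOf K).ncard = (T.edgesOf K).ncard + (T.edgesOf K).ncard := by
    rw [h1, Set.ncard_union_eq ?_ (finite_edgesOf hK) ((finite_edgesOf hK).image _),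
      Set.ncard_image_of_injective _ T.mate_injective]
    rw [Set.disjoint_left]
    rintro _ h ⟨t, ht, rfl⟩
    exact mate_not_mem_edgesOf ht h
  have h4 : (T.sidesOf K).ncard = 3 * K.ncard + (T.boundarySides K).ncard := by
    rw [h2, Set.ncard_union_eq ?_ (finite_sides hK) (finite_boundarySides hK), ncard_sides]
    rw [Set.disjoint_left]
    exact fun s h h' => h'.1 h
  omega

theorem finite_start_mem {W : Set T.Vertex} (hW : W.Finite) (h : ∀ v ∈ W, T.degree v ≠ ⊤) :
    {s | T.start s ∈ W}.Finite := by
  have : {s | T.start s ∈ W} = ⋃ v ∈ W, {s | T.start s = v} := by ext; simp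
  rw [this]
  exact hW.biUnion fun v hv => Set.encard_ne_top_iff.1 (h v hv)

/-- A side that starts at a given vertex. -/
noncomputable def someSide (T : TriangleGluing) (v : T.Vertex) : T.Side :=
  Function.surjInv T.start_surjective v

@[simp] theorem start_someSide (T : TriangleGluing) (v : T.Vertex) : T.start (T.someSide v) = v :=
  Function.surjInv_eq T.start_surjective v

theorem ncard_start_mem {W : Set T.Vertex} (h : ∀ v ∈ W, T.degree v = 6) :
    {s | T.start s ∈ W}.ncard = 6 * W.ncard := by
  have hp := fun v (hv : v ∈ W) => T.iterate_of_degree (s := T.someSide v) (n := 6) (by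
    rw [start_someSide, h v hv]; rfl)
  have himg : {s | T.start s ∈ W} = (fun p : T.Vertex × ℕ => T.rotate^[p.2] (T.someSide p.1)) ''
      (W ×ˢ (Finset.range 6 : Set ℕ)) := by
    ext s
    constructor
    · intro hs
      obtain ⟨j, hj, hjs⟩ := T.exists_iterate_of_start_eq (by norm_num) (hp _ hs).1 (T.start_someSide _).symm
      exact ⟨(T.start s, j), ⟨hs, by simpa using hj⟩, hjs⟩
    · rintro ⟨⟨v, j⟩, ⟨hv, -⟩, rfl⟩
      change T.start (T.rotate^[j] (T.someSide v)) ∈ W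
      rw [start_iterate, start_someSide]
      exact hv
  rw [himg, Set.InjOn.ncard_image, Set.ncard_prod, Set.ncard_coe_finset, Finset.card_range,
    mul_comm]
  rintro ⟨v, i⟩ ⟨hv, hi⟩ ⟨w, j⟩ ⟨-, hj⟩ hij
  dsimp only at hij hi hj hv
  have hvw : v = w := by
    have := congrArg T.start hij
    rwa [start_iterate, start_iterate, start_someSide, start_someSide] at this
  subst hvw
  rw [(hp v hv).2 i (by simpa using hi) j (by simpa using hj) hij]

end edges

theorem finite_box (n : ℕ) : (box n).Finite := by
  have h := (Set.finite_Ico (-(n : ℤ)) n).prod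
    ((Set.finite_Ico (-(n : ℤ)) n).prod (Set.finite_univ (α := Bool)))
  exact h.subset fun f hf => ⟨hf.1, hf.2, trivial⟩

theorem ncard_box (n : ℕ) : (box n).ncard = 8 * n ^ 2 := by
  have h : box n = Set.Ico (-(n : ℤ)) n ×ˢ (Set.Ico (-(n : ℤ)) n ×ˢ (Set.univ : Set Bool)) := by
    ext f
    change ((-(n : ℤ) ≤ f.1 ∧ f.1 < n) ∧ -(n : ℤ) ≤ f.2.1 ∧ f.2.1 < n) ↔
      ((-(n : ℤ) ≤ f.1 ∧ f.1 < n) ∧ (-(n : ℤ) ≤ f.2.1 ∧ f.2.1 < n) ∧ True)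
    simp
  have h1 : (Set.Ico (-(n : ℤ)) n).ncard = 2 * n := by
    rw [← Finset.coe_Ico, Set.ncard_coe_finset, Int.card_Ico]
    omega
  have h2 : (box n).ncard = (Set.Ico (-(n : ℤ)) n ×ˢ (Set.Ico (-(n : ℤ)) n ×ˢ
    (Set.univ : Set Bool)) : Set (ℤ × ℤ × Bool)).ncard := congrArg Set.ncard h
  rw [h2, Set.ncard_prod, Set.ncard_prod, h1, Set.ncard_univ]
  simp
  ring

theorem mem_verticesOf_box {n : ℕ} (hn : 1 ≤ n) (t : regular.Side) :
    regular.start t ∈ regular.verticesOf (box n) ↔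
      corner t ∈ Set.Icc (-(n : ℤ)) n ×ˢ Set.Icc (-(n : ℤ)) n := by
  constructor
  · rintro ⟨s, hs, hst⟩
    have h1 : corner s = corner t := regular_start_eq_iff.1 hst
    rw [← h1]
    exact corner_of_mem_box hs
  · rintro ⟨⟨h1, h2⟩, h3, h4⟩
    have key : ∀ s : (ℤ × ℤ × Bool) × Fin 3, s.1 ∈ box n → corner s = corner t →
        regular.start t ∈ regular.verticesOf (box n) := fun s hs h =>
      ⟨s, hs, regular_start_eq_iff.2 h⟩
    generalize hxy : corner t = p at *
    obtain ⟨x, y⟩ := p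
    dsimp only at h1 h2 h3 h4
    by_cases hx : x = n <;> by_cases hy : y = n
    · refine key ((x - 1, y - 1, false), 0) (mem_box.2 (by omega)) ?_
      simp [corner, regularCorner]
    · refine key ((x - 1, y, true), 1) (mem_box.2 (by omega)) ?_
      simp [corner, regularCorner]
    · refine key ((x, y - 1, true), 2) (mem_box.2 (by omega)) ?_
      simp [corner, regularCorner]
    · exact key ((x, y, true), 0) (mem_box.2 (by omega)) rfl

theorem ncard_verticesOf_box {n : ℕ} (hn : 1 ≤ n) :
    (regular.verticesOf (box n)).ncard = (2 * n + 1) ^ 2 := by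
  have hcor : ∀ x, corner (regularBase x) = x := fun x => rfl
  have h : regular.verticesOf (box n) = (fun x => regular.start (regularBase x)) ''
      (Set.Icc (-(n : ℤ)) n ×ˢ Set.Icc (-(n : ℤ)) n) := by
    ext v
    constructor
    · intro hv
      obtain ⟨t, rfl⟩ := regular.start_surjective v
      exact ⟨corner t, (mem_verticesOf_box hn t).1 hv, regular_start_eq_iff.2 rfl⟩
    · rintro ⟨x, hx, rfl⟩
      exact (mem_verticesOf_box hn _).2 hx
  have h1 : (Set.Icc (-(n : ℤ)) n).ncard = 2 * n + 1 := by
    rw [← Finset.coe_Icc, Set.ncard_coe_finset, Int.card_Icc]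
    omega
  rw [h, Set.ncard_image_of_injective, Set.ncard_prod, h1, sq]
  intro x y hxy
  exact regular_start_eq_iff.1 hxy

theorem regular_degree (v : regular.Vertex) : regular.degree v = 6 := by
  obtain ⟨s, rfl⟩ := regular.start_surjective v
  exact regular.degree_of_iterate (by norm_num) (regular_rotate_six s) (regular_rotate_injective s)

/-- The sides outside `K` that start at vertices of `K`. -/
def collarSides (T : TriangleGluing) (K : Set T.Face) : Set T.Side :=
  {s | s.1 ∉ K ∧ T.start s ∈ T.verticesOf K}

theorem start_mem_verticesOf_eq (T : TriangleGluing) (K : Set T.Face) :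
    {s | T.start s ∈ T.verticesOf K} = {s | s.1 ∈ K} ∪ T.collarSides K := by
  ext s
  constructor
  · intro h
    by_cases hs : s.1 ∈ K
    · exact Or.inl hs
    · exact Or.inr ⟨hs, h⟩
  · rintro (h | h)
    · exact ⟨s, h, rfl⟩
    · exact h.2

theorem ncard_start_mem_verticesOf {T : TriangleGluing} {K : Set T.Face} (hK : K.Finite)
    (hc : (T.collarSides K).Finite) :
    {s | T.start s ∈ T.verticesOf K}.ncard = 3 * K.ncard + (T.collarSides K).ncard := by
  rw [start_mem_verticesOf_eq, Set.ncard_union_eq ?_ (finite_sides hK) hc, ncard_sides]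
  rw [Set.disjoint_left]
  exact fun s h h' => h'.1 h

theorem finite_collarSides_box (n : ℕ) : (regular.collarSides (box n)).Finite :=
  (finite_start_mem (finite_verticesOf (finite_box n)) fun v _ => by
    rw [regular_degree]; decide).subset fun _ hs => hs.2

/-- The sides starting at the `(2n+1)²` lattice points of the rhombus number `6(2n+1)²`, and `3 ·
8n²` of them lie inside. -/
theorem ncard_collarSides_box {n : ℕ} (hn : 1 ≤ n) :
    (regular.collarSides (box n)).ncard = 24 * n + 6 := by
  have h1 := ncard_start_mem_verticesOf (finite_box n) (finite_collarSides_box n)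
  rw [ncard_start_mem fun v _ => regular_degree v, ncard_verticesOf_box hn, ncard_box] at h1
  have : 6 * (2 * n + 1) ^ 2 = 3 * (8 * n ^ 2) + (24 * n + 6) := by ring
  omega

theorem ncard_boundarySides_box {n : ℕ} (hn : 1 ≤ n) :
    (regular.boundarySides (box n)).ncard = 8 * n := by
  -- The second component names the bottom, top, left or right edge of the rhombus.
  set g : ℤ × Fin 4 → (ℤ × ℤ × Bool) × Fin 3 := fun p =>
    match p with
    | (k, 0) => ((k, -(n : ℤ) - 1, false), 0)
    | (k, 1) => ((k, (n : ℤ), true), 0)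
    | (k, 2) => ((-(n : ℤ) - 1, k, false), 2)
    | (k, 3) => (((n : ℤ), k, true), 2) with hg
  have h : regular.boundarySides (box n) =
      g '' (Set.Ico (-(n : ℤ)) n ×ˢ (Set.univ : Set (Fin 4))) := by
    ext t
    constructor
    · intro ht
      obtain ⟨⟨⟨m, k, b⟩, i⟩, rfl⟩ : ∃ t' : (ℤ × ℤ × Bool) × Fin 3, t = t' := ⟨t, rfl⟩
      obtain ⟨h1, h2⟩ := ht
      change ((m, k, b) : ℤ × ℤ × Bool) ∉ box n at h1
      rw [mem_box] at h1
      change (-(n : ℤ) ≤ (regularMate ((m, k, b), i)).1.1 ∧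
        (regularMate ((m, k, b), i)).1.1 < n) ∧ -(n : ℤ) ≤ (regularMate ((m, k, b), i)).1.2.1 ∧
        (regularMate ((m, k, b), i)).1.2.1 < n at h2
      cases b <;> fin_cases i <;> simp only [regularMate] at h2
      · refine ⟨(m, 0), ⟨⟨by omega, by omega⟩, trivial⟩, ?_⟩
        rw [show k = -(n : ℤ) - 1 by omega]
        rfl
      · exact absurd h2 h1
      · refine ⟨(k, 2), ⟨⟨by omega, by omega⟩, trivial⟩, ?_⟩
        rw [show m = -(n : ℤ) - 1 by omega]
        rfl
      · refine ⟨(m, 1), ⟨⟨by omega, by omega⟩, trivial⟩, ?_⟩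
        rw [show k = n by omega]
        rfl
      · exact absurd h2 h1
      · refine ⟨(k, 3), ⟨⟨by omega, by omega⟩, trivial⟩, ?_⟩
        rw [show m = n by omega]
        rfl
    · rintro ⟨⟨k, j⟩, ⟨⟨h1, h2⟩, -⟩, rfl⟩
      dsimp only at h1 h2
      change (g (k, j)).1 ∉ box n ∧ (regularMate (g (k, j))).1 ∈ box n
      fin_cases j <;> simp only [hg, regularMate] <;> rw [mem_box, mem_box] <;> omega
  have h1 : (Set.Ico (-(n : ℤ)) n).ncard = 2 * n := by
    rw [← Finset.coe_Ico, Set.ncard_coe_finset, Int.card_Ico]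
    omega
  refine (congrArg Set.ncard h).trans ?_
  change (g '' (Set.Ico (-(n : ℤ)) n ×ˢ (Set.univ : Set (Fin 4)))).ncard = 8 * n
  rw [Set.ncard_image_of_injective, Set.ncard_prod, h1, Set.ncard_univ, Nat.card_fin]
  · ring
  · rintro ⟨k, i⟩ ⟨l, j⟩ hij
    fin_cases i <;> fin_cases j <;> simp [hg] at hij ⊢ <;> omega

namespace OuterIso

variable {T : TriangleGluing} {K : Set T.Face} {L : Set regular.Face}

theorem injOn_map (e : OuterIso T regular K L) : Set.InjOn e.map {s | s.1 ∉ K} := by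
  intro s hs t ht h
  rw [← e.inv_to s hs, h, e.inv_to t ht]

theorem map_boundarySides (e : OuterIso T regular K L) : e.map '' T.boundarySides K = regular.boundarySides L := by
  ext t
  constructor
  · rintro ⟨s, ⟨h1, h2⟩, rfl⟩
    exact ⟨e.to_outer s h1, not_not.1 ((not_iff_not.2 (e.mate_outer_iff s h1)).1 (not_not.2 h2))⟩
  · rintro ⟨h1, h2⟩
    exact ⟨e.inv t, ⟨e.inv_outer t h1,
      not_not.1 ((not_iff_not.2 (e.symm.mate_outer_iff t h1)).1 (not_not.2 h2))⟩, e.to_inv t h1⟩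

theorem map_collarSides (e : OuterIso T regular K L) : e.map '' T.collarSides K = regular.collarSides L := by
  ext t
  constructor
  · rintro ⟨s, ⟨h1, h2⟩, rfl⟩
    exact ⟨e.to_outer s h1, (e.mem_verticesOf_iff s h1).1 h2⟩
  · rintro ⟨h1, h2⟩
    refine ⟨e.inv t, ⟨e.inv_outer t h1, (e.mem_verticesOf_iff _ (e.inv_outer t h1)).2 ?_⟩,
      e.to_inv t h1⟩
    rwa [e.to_inv t h1]

theorem ncard_boundarySides (e : OuterIso T regular K L) : (T.boundarySides K).ncard = (regular.boundarySides L).ncard := by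
  rw [← e.map_boundarySides, Set.InjOn.ncard_image (e.injOn_map.mono fun s hs => hs.1)]

theorem ncard_collarSides (e : OuterIso T regular K L) : (T.collarSides K).ncard = (regular.collarSides L).ncard := by
  rw [← e.map_collarSides, Set.InjOn.ncard_image (e.injOn_map.mono fun s hs => hs.1)]

theorem finite_collarSides (e : OuterIso T regular K L) (h : (regular.collarSides L).Finite) : (T.collarSides K).Finite := by
  rw [← e.map_collarSides] at h
  exact h.of_finite_image (e.injOn_map.mono fun s hs => hs.1)

end OuterIso

/-- The number of sides that start at exceptional vertices, in terms of the numbers of vertices and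
triangles of a piece outside which the surface is the outside of a rhombus in the regular
triangulation. -/
theorem OuterIso.ncard_start_exceptional {T : TriangleGluing} {K : Set T.Face} (hK : K.Finite)
    {n : ℕ} (hn : 1 ≤ n) (e : OuterIso T regular K (box n)) :
    {s | T.start s ∈ T.exceptional}.ncard + 6 * (T.verticesOf K).ncard =
      3 * K.ncard + 24 * n + 6 + 6 * T.exceptional.ncard ∧
      {s | T.start s ∈ T.exceptional}.Finite := by
  have hcol := e.finite_collarSides (finite_collarSides_box n)
  have hfin : {s | T.start s ∈ T.verticesOf K}.Finite := by
    rw [start_mem_verticesOf_eq]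
    exact (finite_sides hK).union hcol
  have hexc := e.exceptional_subset
  have h1 := ncard_start_mem_verticesOf hK hcol
  rw [e.ncard_collarSides, ncard_collarSides_box hn] at h1
  have h2 : {s | T.start s ∈ T.verticesOf K} =
      {s | T.start s ∈ T.verticesOf K \ T.exceptional} ∪ {s | T.start s ∈ T.exceptional} := by
    ext s
    change T.start s ∈ T.verticesOf K ↔ (T.start s ∈ T.verticesOf K ∧ T.start s ∉ T.exceptional) ∨
      T.start s ∈ T.exceptional
    have := @hexc (T.start s)
    tauto
  have hf2 : {s | T.start s ∈ T.exceptional}.Finite := hfin.subset fun s hs => hexc hs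
  have h3 : {s | T.start s ∈ T.verticesOf K \ T.exceptional}.ncard =
      6 * (T.verticesOf K \ T.exceptional).ncard :=
    ncard_start_mem fun v hv => not_not.1 hv.2
  rw [h2, Set.ncard_union_eq ?_ (hfin.subset fun s hs => hs.1) hf2, h3] at h1
  · have h4 := Set.ncard_sdiff_add_ncard_of_subset hexc (finite_verticesOf hK)
    exact ⟨by omega, hf2⟩
  · rw [Set.disjoint_left]
    exact fun s h h' => h.2 h'


/-! ### Cochains -/

section extend

variable (T : TriangleGluing) (K : Set T.Face) {k : Type*} [CommRing k] (ε : k)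

open Classical in
/-- The function on all sides, supported on the sides of `K`, with given values on the chosen
representatives and multiplied by `ε` under passing to the partner. -/
noncomputable def extendEdges : (T.edgesOf K → k) →ₗ[k] (T.Side → k) where
  toFun g s := if h : s ∈ T.edgesOf K then g ⟨s, h⟩ else
    if h : T.mate s ∈ T.edgesOf K then ε * g ⟨T.mate s, h⟩ else 0
  map_add' g g' := by
    funext s
    simp only [Pi.add_apply]
    split_ifs <;> ring
  map_smul' c g := by
    funext s
    simp only [Pi.smul_apply, smul_eq_mul, RingHom.id_apply]
    split_ifs <;> ring

variable {T K ε}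

theorem extendEdges_of_mem (g : T.edgesOf K → k) {s : T.Side} (h : s ∈ T.edgesOf K) :
    T.extendEdges K ε g s = g ⟨s, h⟩ := dif_pos h

theorem extendEdges_of_mate_mem (g : T.edgesOf K → k) {s : T.Side} (h : T.mate s ∈ T.edgesOf K) :
    T.extendEdges K ε g s = ε * g ⟨T.mate s, h⟩ := by
  have h1 : s ∉ T.edgesOf K := fun h' => mate_not_mem_edgesOf h' h
  exact (dif_neg h1).trans (dif_pos h)

theorem extendEdges_of_not_mem (g : T.edgesOf K → k) {s : T.Side} (h : s ∉ T.sidesOf K) :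
    T.extendEdges K ε g s = 0 :=
  (dif_neg fun h' => h h'.1).trans (dif_neg fun h' => h (T.mate_mem_sidesOf.1 h'.1))

theorem extendEdges_mate (hε : ε * ε = 1) (g : T.edgesOf K → k) (s : T.Side) :
    T.extendEdges K ε g (T.mate s) = ε * T.extendEdges K ε g s := by
  by_cases h : s ∈ T.sidesOf K
  · rcases mem_edgesOf_or h with h | h
    · have h' : T.mate (T.mate s) ∈ T.edgesOf K := by rwa [T.mate_mate]
      rw [extendEdges_of_mate_mem g h', extendEdges_of_mem g h]
      congr 2
      exact Subtype.ext (T.mate_mate s)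
    · rw [extendEdges_of_mem g h, extendEdges_of_mate_mem g h, ← mul_assoc, hε, one_mul]
  · rw [extendEdges_of_not_mem g h, extendEdges_of_not_mem g (T.mate_mem_sidesOf.not.2 h), mul_zero]

theorem extendEdges_restrict {f : T.Side → k} (hf : ∀ s, f (T.mate s) = ε * f s)
    (h0 : ∀ s ∉ T.sidesOf K, f s = 0) (s : T.Side) :
    T.extendEdges K ε (fun s => f s.1) s = f s := by
  by_cases h : s ∈ T.sidesOf K
  · rcases mem_edgesOf_or h with h | h
    · rw [extendEdges_of_mem _ h]
    · rw [extendEdges_of_mate_mem _ h, ← hf, T.mate_mate]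
  · rw [extendEdges_of_not_mem _ h, h0 s h]

end extend

/-- Euler's inequality for a piece on which all integral cocycles are coboundaries. -/
theorem ncard_edgesOf_lt {T : TriangleGluing} {K : Set T.Face} (hK : K.Finite) (hne : K.Nonempty)
    (hcob : ∀ c : T.Side → ℤ, (∀ s, c (T.mate s) = -c s) →
      (∀ f ∈ K, c (f, 0) + c (f, 1) + c (f, 2) = 0) →
      ∃ ψ : T.Vertex → ℤ, ∀ s ∈ T.sidesOf K, c s = ψ (T.start (T.mate s)) - ψ (T.start s)) :
    (T.edgesOf K).ncard + 1 ≤ (T.verticesOf K).ncard + K.ncard := by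
  have := hK.to_subtype
  have := (finite_edgesOf hK).to_subtype
  have := (finite_verticesOf hK).to_subtype
  set δ : (T.verticesOf K → ℚ) →ₗ[ℚ] (T.edgesOf K → ℚ) :=
    { toFun := fun ψ s => ψ ⟨T.start (T.mate s.1), start_mem_verticesOf T
        (T.mate_mem_sidesOf.2 s.2.1)⟩ - ψ ⟨T.start s.1, start_mem_verticesOf T s.2.1⟩
      map_add' := fun ψ ψ' => by funext s; simp only [Pi.add_apply]; ring
      map_smul' := fun c ψ => by
        funext s; simp only [Pi.smul_apply, smul_eq_mul, RingHom.id_apply]; ring } with hδ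
  set d : (T.edgesOf K → ℚ) →ₗ[ℚ] (K → ℚ) :=
    { toFun := fun g f => T.extendEdges K (-1) g (f.1, 0) + T.extendEdges K (-1) g (f.1, 1) +
        T.extendEdges K (-1) g (f.1, 2)
      map_add' := fun g g' => by
        funext f; rw [map_add]; simp only [Pi.add_apply]; ring
      map_smul' := fun c g => by
        funext f
        rw [map_smul]
        simp only [Pi.smul_apply, smul_eq_mul, RingHom.id_apply]; ring } with hd
  have hker : LinearMap.ker d ≤ LinearMap.range δ := by
    intro g hg
    -- Clearing denominators reduces exactness over `ℚ` to the integral hypothesis.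
    obtain ⟨⟨b, hb⟩, hbg⟩ := IsLocalization.exist_integer_multiples_of_finite
      (nonZeroDivisors ℤ) g
    choose z hz using hbg
    have hb0 : (b : ℚ) ≠ 0 := by exact_mod_cast nonZeroDivisors.ne_zero hb
    have hz' : ∀ s, (z s : ℚ) = b * g s := fun s => by simpa using hz s
    have hext : ∀ s, ((T.extendEdges K (-1) z s : ℤ) : ℚ) = b * T.extendEdges K (-1) g s := by
      intro s
      by_cases h : s ∈ T.sidesOf K
      · rcases mem_edgesOf_or h with h | h
        · rw [extendEdges_of_mem _ h, extendEdges_of_mem _ h, hz']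
        · rw [extendEdges_of_mate_mem _ h, extendEdges_of_mate_mem _ h]
          push_cast
          rw [hz']
          ring
      · rw [extendEdges_of_not_mem _ h, extendEdges_of_not_mem _ h]
        simp
    obtain ⟨ψ, hψ⟩ := hcob (T.extendEdges K (-1) z)
      (fun s => by rw [extendEdges_mate (by norm_num)]; ring) (by
        intro f hf
        have h1 := congrFun (LinearMap.mem_ker.1 hg) ⟨f, hf⟩
        simp only [hd, LinearMap.coe_mk, AddHom.coe_mk, Pi.zero_apply] at h1
        have h2 : ((T.extendEdges K (-1) z (f, 0) + T.extendEdges K (-1) z (f, 1) +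
            T.extendEdges K (-1) z (f, 2) : ℤ) : ℚ) = 0 := by
          push_cast
          rw [hext, hext, hext]
          linear_combination (b : ℚ) * h1
        exact_mod_cast h2)
    refine ⟨fun v => (ψ v.1 : ℚ) / b, ?_⟩
    funext s
    have h1 := hψ s.1 s.2.1
    rw [extendEdges_of_mem _ s.2] at h1
    have h2 : (b : ℚ) * g s = ψ (T.start (T.mate s.1)) - ψ (T.start s.1) := by
      rw [← hz']
      exact_mod_cast h1
    simp only [hδ, LinearMap.coe_mk, AddHom.coe_mk]
    field_simp
    linear_combination -h2
  have h1 := LinearMap.finrank_range_add_finrank_ker d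
  have h2 := LinearMap.finrank_range_add_finrank_ker δ
  have h3 := Submodule.finrank_mono hker
  have h4 : Module.finrank ℚ (LinearMap.range d) ≤ K.ncard := by
    have := Submodule.finrank_le (LinearMap.range d)
    have := Fintype.ofFinite K
    rwa [Module.finrank_fintype_fun_eq_card, ← Nat.card_eq_fintype_card, Nat.card_coe_set_eq] at *
  -- The constants lie in the kernel of `δ`; they account for the `1` in Euler's inequality.
  have h5 : 1 ≤ Module.finrank ℚ (LinearMap.ker δ) := by
    rw [Nat.one_le_iff_ne_zero, Ne, Submodule.finrank_eq_zero]
    intro h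
    have h6 : (fun _ => 1 : T.verticesOf K → ℚ) ∈ LinearMap.ker δ := by
      rw [LinearMap.mem_ker]
      funext s
      simp [hδ]
    rw [h, Submodule.mem_bot] at h6
    obtain ⟨f, hf⟩ := hne
    have := congrFun h6 ⟨T.start (f, 0), ⟨(f, 0), hf, rfl⟩⟩
    simp at this
  have h6 : Module.finrank ℚ (T.edgesOf K → ℚ) = (T.edgesOf K).ncard := by
    have := Fintype.ofFinite (T.edgesOf K)
    rw [Module.finrank_fintype_fun_eq_card, ← Nat.card_eq_fintype_card, Nat.card_coe_set_eq]
  have h7 : Module.finrank ℚ (T.verticesOf K → ℚ) = (T.verticesOf K).ncard := by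
    have := Fintype.ofFinite (T.verticesOf K)
    rw [Module.finrank_fintype_fun_eq_card, ← Nat.card_eq_fintype_card, Nat.card_coe_set_eq]
  omega


/-! ### Developing maps -/

section lattice

variable {k : Type*} [Field k] (ω : k)

/-- The position of a lattice point. -/
def latticePos (x : ℤ × ℤ) : k := x.1 + x.2 * (1 + ω)

/-- The inverse of the direction of a side of the regular triangulation. -/
def invDir (t : regular.Side) : k := (if t.1.2.2 then 1 else -1) * (ω ^ 2) ^ (t.2 : ℕ)

/-- The position of `q` in the coordinates in which a side goes from `0` to `1`. -/
def latticeDev (q : k) (t : regular.Side) : k := (q - latticePos ω (corner t)) * invDir ω t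

variable {ω}

theorem pow_three_eq_one_of_sq (hω : ω ^ 2 + ω + 1 = 0) : ω ^ 3 = 1 := by
  linear_combination (ω - 1) * hω

theorem invDir_next (hω : ω ^ 2 + ω + 1 = 0) (t : regular.Side) :
    invDir ω (regular.next t) = ω ^ 2 * invDir ω t := by
  have h3 := pow_three_eq_one_of_sq hω
  obtain ⟨⟨m, n, b⟩, i⟩ := t
  cases b <;> fin_cases i <;> simp [invDir, next] <;>
    first | ring1 | linear_combination -(ω ^ 3 + 1) * h3

theorem invDir_mate (t : regular.Side) :
    invDir ω (regular.mate t) = -invDir ω t := by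
  change invDir ω (regularMate t) = _
  obtain ⟨⟨m, n, b⟩, i⟩ := t
  cases b <;> fin_cases i <;> simp [invDir, regularMate]

theorem invDir_ne_zero (hω : ω ^ 2 + ω + 1 = 0) (t : regular.Side) :
    invDir ω t ≠ 0 := by
  have h0 : ω ≠ 0 := by
    rintro rfl
    norm_num at hω
  refine mul_ne_zero ?_ (pow_ne_zero _ (pow_ne_zero _ h0))
  split_ifs <;> simp

theorem latticePos_next (hω : ω ^ 2 + ω + 1 = 0) (t : regular.Side) :
    (latticePos ω (corner (regular.next t)) - latticePos ω (corner t)) * invDir ω t = 1 := by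
  have h3 := pow_three_eq_one_of_sq hω
  have hn : corner (regular.next t) = regularCorner t.1 (t.2 + 1) := rfl
  rw [hn]
  obtain ⟨⟨m, n, b⟩, i⟩ := t
  cases b <;> fin_cases i <;> simp [invDir, latticePos, regularCorner, corner]
  · linear_combination h3
  · linear_combination (ω ^ 3 + 1) * h3 - ω ^ 4 * hω
  · linear_combination h3
  · linear_combination (-ω ^ 2 * (ω ^ 2 - ω) - ω ^ 3) * hω + (ω ^ 3 + 1) * h3

/-- In the coordinate of a side its triangle is the standard one, so passing to the next side is a
fixed affine map that does not depend on the triangle or on `q`. -/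
theorem latticeDev_next (hω : ω ^ 2 + ω + 1 = 0) (q : k) (t : regular.Side) :
    latticeDev ω q (regular.next t) = ω ^ 2 * (latticeDev ω q t - 1) := by
  have h := latticePos_next hω t
  unfold latticeDev
  rw [invDir_next hω]
  linear_combination -ω ^ 2 * h

theorem latticeDev_mate (hω : ω ^ 2 + ω + 1 = 0) (q : k) (t : regular.Side) :
    latticeDev ω q (regular.mate t) = 1 - latticeDev ω q t := by
  have h := latticePos_next hω t
  rw [corner_next] at h
  unfold latticeDev
  rw [invDir_mate]
  linear_combination h

end lattice

section telescope

variable {k : Type*} [Field k] {T : TriangleGluing} {χ : k} {P z : T.Side → k}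

theorem iterate_rotate_eq_sum (h : ∀ t, P (T.rotate t) = χ * P t + z (T.next.symm t)) (t : T.Side)
    (n : ℕ) : P (T.rotate^[n] t) = χ ^ n * P t +
      ∑ j ∈ Finset.range n, χ ^ (n - 1 - j) * z (T.next.symm (T.rotate^[j] t)) := by
  induction n with
  | zero => simp
  | succ n ih =>
    rw [Function.iterate_succ_apply', h, ih, Finset.sum_range_succ, mul_add, Finset.mul_sum]
    have : ∑ j ∈ Finset.range n, χ * (χ ^ (n - 1 - j) * z (T.next.symm (T.rotate^[j] t))) =
        ∑ j ∈ Finset.range n, χ ^ (n + 1 - 1 - j) * z (T.next.symm (T.rotate^[j] t)) := by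
      refine Finset.sum_congr rfl fun j hj => ?_
      rw [← mul_assoc, ← pow_succ']
      congr 2
      have := Finset.mem_range.1 hj
      omega
    rw [this]
    simp
    ring

/-- A full turn about a vertex of degree `6` has trivial linear holonomy, so the accumulated defects
must cancel. This is the cocycle condition at ordinary vertices. -/
theorem sum_rotate_eq_zero (h : ∀ t, P (T.rotate t) = χ * P t + z (T.next.symm t))
    (hχ : χ ^ 6 = 1) {t : T.Side} (ht : T.rotate^[6] t = t) :
    ∑ j ∈ Finset.range 6, χ ^ (5 - j) * z (T.next.symm (T.rotate^[j] t)) = 0 := by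
  have := iterate_rotate_eq_sum h t 6
  rw [ht, hχ, one_mul] at this
  exact left_eq_add.1 this

end telescope

/-! ### The twisted cochain complex -/

namespace OuterIso

variable {k : Type*} [Field k] {T : TriangleGluing} {K : Set T.Face} {L : Set regular.Face}
  (e : OuterIso T regular K L) (ω : k)

open Classical in
/-- Rotation equivariant functions on the sides, arbitrary on the triangles of `K` and constant
outside `K`. -/
noncomputable def faceCochain : ((K → k) × k) →ₗ[k] (T.Side → k) where
  toFun x s := if h : s.1 ∈ K then (ω ^ 2) ^ (s.2 : ℕ) * x.1 ⟨s.1, h⟩ else x.2 * invDir ω (e.map s)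
  map_add' x y := by
    funext s
    simp only [Pi.add_apply, Prod.fst_add, Prod.snd_add]
    split_ifs <;> ring
  map_smul' c x := by
    funext s
    simp only [Pi.smul_apply, smul_eq_mul, RingHom.id_apply, Prod.smul_fst, Prod.smul_snd]
    split_ifs <;> ring

variable {e ω}

theorem faceCochain_of_mem (x : (K → k) × k) {s : T.Side} (h : s.1 ∈ K) :
    e.faceCochain ω x s = (ω ^ 2) ^ (s.2 : ℕ) * x.1 ⟨s.1, h⟩ := dif_pos h

theorem faceCochain_of_not_mem (x : (K → k) × k) {s : T.Side} (h : s.1 ∉ K) :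
    e.faceCochain ω x s = x.2 * invDir ω (e.map s) := dif_neg h

theorem faceCochain_next (hω : ω ^ 2 + ω + 1 = 0) (x : (K → k) × k) (s : T.Side) :
    e.faceCochain ω x (T.next s) = ω ^ 2 * e.faceCochain ω x s := by
  have h3 := pow_three_eq_one_of_sq hω
  by_cases h : s.1 ∈ K
  · rw [faceCochain_of_mem x h, faceCochain_of_mem x (s := T.next s) h]
    change _ * x.1 ⟨s.1, h⟩ = _
    rw [← mul_assoc]
    congr 1
    obtain ⟨f, i⟩ := s
    fin_cases i <;> simp [next]
    · ring
    · linear_combination -(ω ^ 3 + 1) * h3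
  · rw [faceCochain_of_not_mem x h, faceCochain_of_not_mem x (s := T.next s) h, e.to_next s h,
      invDir_next hω]
    ring

theorem faceCochain_mate (x : (K → k) × k) {s : T.Side} (h : s ∉ T.sidesOf K) :
    e.faceCochain ω x (T.mate s) = -e.faceCochain ω x s := by
  have h1 : s.1 ∉ K := fun h' => h (Or.inl h')
  have h2 : (T.mate s).1 ∉ K := fun h' => h (Or.inr h')
  rw [faceCochain_of_not_mem x h1, faceCochain_of_not_mem x h2, e.to_mate s h1 h2, invDir_mate]
  ring

variable (e ω)

/-- The failure of a function on sides to change sign under passing to the partner. -/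
noncomputable def edgeDefect : ((K → k) × k) →ₗ[k] (T.edgesOf K → k) where
  toFun x s := e.faceCochain ω x (T.mate s) + e.faceCochain ω x s
  map_add' x y := by
    funext s
    rw [map_add]
    simp only [Pi.add_apply]
    ring
  map_smul' c x := by
    funext s
    rw [map_smul]
    simp only [Pi.smul_apply, smul_eq_mul, RingHom.id_apply]
    ring

variable {e ω}

theorem extend_edgeDefect (x : (K → k) × k) (s : T.Side) :
    T.extendEdges K 1 (e.edgeDefect ω x) s =
      e.faceCochain ω x (T.mate s) + e.faceCochain ω x s := by
  refine extendEdges_restrict (f := fun s => e.faceCochain ω x (T.mate s) + e.faceCochain ω x s)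
    (fun s => ?_) (fun s hs => ?_) s
  · rw [T.mate_mate]; ring
  · rw [faceCochain_mate x hs]; ring

theorem faceCochain_rotate (hω : ω ^ 2 + ω + 1 = 0) (x : (K → k) × k) (t : T.Side) :
    e.faceCochain ω x (T.rotate t) = -ω * e.faceCochain ω x t +
      T.extendEdges K 1 (e.edgeDefect ω x) (T.next.symm t) := by
  have h3 := pow_three_eq_one_of_sq hω
  have h := faceCochain_next (e := e) hω x (T.next.symm t)
  rw [Equiv.apply_symm_apply] at h
  rw [extend_edgeDefect, rotate_apply, h]
  linear_combination e.faceCochain ω x (T.next.symm t) * h3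

/-- A function without defect is multiplied by `(-ω) ^ d ≠ 1` on a full turn, so it vanishes at
`t₀`; by connectedness it vanishes everywhere. The side `s₁` detects the value at infinity. -/
theorem edgeDefect_injective (hω : ω ^ 2 + ω + 1 = 0) (hT : T.IsPlane) {t₀ : T.Side} {d : ℕ}
    (ht₀ : T.rotate^[d] t₀ = t₀) (hd : (-ω) ^ d ≠ 1) {s₁ : T.Side} (hs₁ : s₁.1 ∉ K) :
    Function.Injective (e.edgeDefect ω) := by
  rw [injective_iff_map_eq_zero]
  intro x hx
  have hmate : ∀ s, e.faceCochain ω x (T.mate s) = -e.faceCochain ω x s := by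
    intro s
    have h := extend_edgeDefect (e := e) (ω := ω) x s
    rw [hx, map_zero, Pi.zero_apply] at h
    linear_combination -h
  have hrot : ∀ n, e.faceCochain ω x (T.rotate^[n] t₀) = (-ω) ^ n * e.faceCochain ω x t₀ := by
    intro n
    induction n with
    | zero => simp
    | succ n ih =>
      rw [Function.iterate_succ_apply', faceCochain_rotate hω, hx, map_zero, ih, Pi.zero_apply]
      ring
  have h0 : e.faceCochain ω x t₀ = 0 := by
    have h := hrot d
    rw [ht₀] at h
    have h1 : (1 - (-ω) ^ d) * e.faceCochain ω x t₀ = 0 := by linear_combination h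
    exact (mul_eq_zero.1 h1).resolve_left (sub_ne_zero.2 hd.symm)
  have hall : ∀ s, e.faceCochain ω x s = 0 := by
    refine hT.side_induction (fun s h => ?_) (fun s h => ?_) h0
    · rw [faceCochain_next hω, h, mul_zero]
    · rw [hmate, h, neg_zero]
  refine Prod.ext (funext fun f => ?_) ?_
  · have h := hall (f.1, 0)
    rw [faceCochain_of_mem x f.2] at h
    simpa using h
  · have h := hall s₁
    rw [faceCochain_of_not_mem x hs₁] at h
    exact (mul_eq_zero.1 h).resolve_right (invDir_ne_zero hω _)

end OuterIso

section vertexDefect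

variable {k : Type*} [Field k] (T : TriangleGluing) (K : Set T.Face) (ω : k)

/-- The failure of a function on edges to come from a function on faces, at vertices of
degree `6`. -/
noncomputable def vertexDefect :
    (T.edgesOf K → k) →ₗ[k] (↥(T.verticesOf K \ T.exceptional) → k) where
  toFun g v := ∑ j ∈ Finset.range 6,
    (-ω) ^ (5 - j) * T.extendEdges K 1 g (T.next.symm (T.rotate^[j] (T.someSide v.1)))
  map_add' g g' := by
    funext v
    simp only [map_add, Pi.add_apply, mul_add, Finset.sum_add_distrib]
  map_smul' c g := by
    funext v
    simp only [map_smul, Pi.smul_apply, smul_eq_mul, RingHom.id_apply, Finset.mul_sum]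
    exact Finset.sum_congr rfl fun j _ => by ring

variable {T K ω}

theorem rotate_six_someSide {v : T.Vertex} (hv : v ∉ T.exceptional) :
    T.rotate^[6] (T.someSide v) = T.someSide v ∧ ∀ i < 6, ∀ j < 6,
      T.rotate^[i] (T.someSide v) = T.rotate^[j] (T.someSide v) → i = j :=
  T.iterate_of_degree (n := 6) (by rw [start_someSide]; exact not_not.1 hv)

open Classical in
theorem sum_rotate_ite {v : T.Vertex} (hv : v ∉ T.exceptional) (h0 : ω ≠ 0) (t : T.Side) :
    (T.start t ≠ v → ∑ j ∈ Finset.range 6, (-ω) ^ (5 - j) *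
      (if T.rotate^[j] (T.someSide v) = t then (1 : k) else 0) = 0) ∧
    (T.start t = v → ∑ j ∈ Finset.range 6, (-ω) ^ (5 - j) *
      (if T.rotate^[j] (T.someSide v) = t then (1 : k) else 0) ≠ 0) := by
  obtain ⟨h6, hinj⟩ := rotate_six_someSide hv
  constructor
  · intro h
    refine Finset.sum_eq_zero fun j _ => ?_
    rw [if_neg, mul_zero]
    rintro rfl
    exact h (by rw [start_iterate, start_someSide])
  · intro h
    obtain ⟨i, hi, hit⟩ := T.exists_iterate_of_start_eq (by norm_num) h6
      (h.trans (T.start_someSide v).symm)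
    rw [Finset.sum_eq_single i]
    · rw [if_pos hit, mul_one]
      exact pow_ne_zero _ (neg_ne_zero.2 h0)
    · intro j hj hji
      rw [if_neg, mul_zero]
      intro hjt
      exact hji (hinj j (Finset.mem_range.1 hj) i hi (hjt.trans hit.symm))
    · intro h
      exact absurd (Finset.mem_range.2 hi) h

-- The cochain of a single edge has image supported at its two ends, with nonzero coefficients at
-- ordinary ends when the ends differ. Starting from an exceptional vertex, which imposes no
-- condition, the unit vectors enter the range one after another along the edges.
open Classical in
theorem vertexDefect_surjective (h0 : ω ≠ 0) (hK : K.Finite)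
    (hconn : ∀ Q : T.Vertex → Prop,
      (∀ s ∈ T.sidesOf K, Q (T.start s) → Q (T.start (T.mate s))) →
      (∃ v ∈ T.verticesOf K, Q v) → ∀ v ∈ T.verticesOf K, Q v)
    (hexc : ∃ v ∈ T.verticesOf K, v ∈ T.exceptional) :
    Function.Surjective (T.vertexDefect K ω) := by
  -- For an exceptional `v` this property is vacuous, which starts the propagation.
  have hQ := hconn (fun v => ∀ hv : v ∈ T.verticesOf K \ T.exceptional,
    Pi.single (⟨v, hv⟩ : ↥(T.verticesOf K \ T.exceptional)) (1 : k) ∈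
      LinearMap.range (T.vertexDefect K ω)) ?_ ?_
  · have := ((finite_verticesOf hK).subset (Set.sdiff_subset (t := T.exceptional))).to_subtype
    have := Fintype.ofFinite ↥(T.verticesOf K \ T.exceptional)
    rw [← LinearMap.range_eq_top, eq_top_iff]
    intro f _
    rw [← Finset.univ_sum_single f]
    refine Submodule.sum_mem _ fun v _ => ?_
    have h := Submodule.smul_mem _ (f v) (hQ v.1 v.2.1 v.2)
    rw [← Pi.single_smul, smul_eq_mul, mul_one] at h
    exact h
  · intro s hs hQs hb
    by_cases hab : T.start s = T.start (T.mate s)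
    · have : ∀ v (hv : v ∈ T.verticesOf K \ T.exceptional), T.start s = v →
        Pi.single (⟨v, hv⟩ : ↥(T.verticesOf K \ T.exceptional)) (1 : k) ∈
          LinearMap.range (T.vertexDefect K ω) := by
        rintro v hv rfl
        exact hQs hv
      exact this _ hb hab
    set E : T.Side → ↥(T.verticesOf K \ T.exceptional) → k := fun t v =>
      ∑ j ∈ Finset.range 6, (-ω) ^ (5 - j) *
        (if T.rotate^[j] (T.someSide v.1) = t then (1 : k) else 0) with hE
    -- The indicator of the edge of `s`. In `vertexDefect` it is seen from the sides `next s` and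
    -- `next (mate s)`, which start at the two ends of the edge.
    set f : T.Side → k := fun t => (if t = s then 1 else 0) + (if t = T.mate s then 1 else 0)
      with hf
    have hext : ∀ t, T.extendEdges K 1 (fun r : T.edgesOf K => f r.1) t = f t := by
      refine extendEdges_restrict (fun t => ?_) (fun t ht => ?_)
      · simp only [hf, one_mul]
        rw [add_comm]
        congr 1
        · simp only [T.mate_injective.eq_iff]
        · congr 1
          rw [eq_iff_iff]
          constructor
          · rintro rfl; rw [T.mate_mate]
          · rintro rfl; rw [T.mate_mate]
      · have h1 : t ≠ s := by rintro rfl; exact ht hs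
        have h2 : t ≠ T.mate s := by rintro rfl; exact ht (T.mate_mem_sidesOf.2 hs)
        simp [hf, h1, h2]
    have hsum : T.vertexDefect K ω (fun r => f r.1) = E (T.next s) + E (T.next (T.mate s)) := by
      funext v
      simp only [vertexDefect, LinearMap.coe_mk, AddHom.coe_mk, hext, hE, Pi.add_apply,
        ← Finset.sum_add_distrib, ← mul_add]
      simp only [hf, Equiv.symm_apply_eq]
    have hE1 : ∀ t (v : ↥(T.verticesOf K \ T.exceptional)), T.start t = v.1 →
        E t = E t v • Pi.single v (1 : k) := by
      intro t v hv
      funext w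
      rw [Pi.smul_apply, smul_eq_mul]
      by_cases hw : w = v
      · rw [hw, Pi.single_eq_same, mul_one]
      · rw [Pi.single_eq_of_ne hw, mul_zero]
        exact (sum_rotate_ite w.2.2 h0 t).1 fun h => hw (Subtype.ext (h.symm.trans hv))
    have hb' : T.start (T.next s) = T.start (T.mate s) := T.start_next s
    have ha' : T.start (T.next (T.mate s)) = T.start s := by rw [start_next, T.mate_mate]
    have h1 : E (T.next (T.mate s)) ∈ LinearMap.range (T.vertexDefect K ω) := by
      by_cases ha : T.start s ∈ T.verticesOf K \ T.exceptional
      · rw [hE1 _ ⟨_, ha⟩ ha']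
        exact Submodule.smul_mem _ _ (hQs ha)
      · have : E (T.next (T.mate s)) = 0 := by
          funext w
          refine (sum_rotate_ite w.2.2 h0 _).1 ?_
          rw [ha']
          rintro h
          exact ha (h ▸ w.2)
        rw [this]
        exact Submodule.zero_mem _
    have h2 : E (T.next s) ∈ LinearMap.range (T.vertexDefect K ω) := by
      have := Submodule.sub_mem _ (LinearMap.mem_range_self (T.vertexDefect K ω)
        (fun r => f r.1)) h1
      rwa [hsum, add_sub_cancel_right] at this
    rw [hE1 _ ⟨_, hb⟩ hb'] at h2
    have hne : E (T.next s) ⟨_, hb⟩ ≠ 0 := (sum_rotate_ite hb.2 h0 _).2 hb'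
    have h3 := Submodule.smul_mem _ (E (T.next s) ⟨_, hb⟩)⁻¹ h2
    rwa [smul_smul, inv_mul_cancel₀ hne, one_smul] at h3
  · obtain ⟨v, hv, hve⟩ := hexc
    exact ⟨v, hv, fun h => absurd hve h.2⟩

end vertexDefect


/-! ### Exactness and the development -/

namespace OuterIso

variable {k : Type*} [Field k] {T : TriangleGluing} {K : Set T.Face} {L : Set regular.Face}
  {e : OuterIso T regular K L} {ω : k}

theorem vertexDefect_edgeDefect (hω : ω ^ 2 + ω + 1 = 0) (x : (K → k) × k) :
    T.vertexDefect K ω (e.edgeDefect ω x) = 0 := by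
  have h6 : (-ω) ^ 6 = 1 := by
    linear_combination (ω ^ 3 + 1) * pow_three_eq_one_of_sq hω
  funext v
  exact sum_rotate_eq_zero (faceCochain_rotate hω x) h6 (rotate_six_someSide v.2.2).1

/-- If the piece `K` has Euler characteristic at least one and exactly two exceptional vertices,
about one of which the holonomy is not trivial, then its Euler characteristic is one, and the point
fixed by the holonomy is a well defined function on the sides, in the coordinates in which
a given side goes from `0` to `1`. -/
theorem exists_development (e : OuterIso T regular K L) (hK : K.Finite) (hT : T.IsPlane)
    (hω : ω ^ 2 + ω + 1 = 0) (hω1 : 1 - ω ^ 2 ≠ 0)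
    (hconn : ∀ Q : T.Vertex → Prop,
      (∀ s ∈ T.sidesOf K, Q (T.start s) → Q (T.start (T.mate s))) →
      (∃ v ∈ T.verticesOf K, Q v) → ∀ v ∈ T.verticesOf K, Q v)
    (hexc : T.exceptional.ncard = 2) {t₀ : T.Side} {d : ℕ}
    (ht₀ : T.rotate^[d] t₀ = t₀) (hd : (-ω) ^ d ≠ 1) {s₁ : T.Side} (hs₁ : s₁.1 ∉ K)
    (hcount : (T.edgesOf K).ncard + 1 ≤ (T.verticesOf K).ncard + K.ncard) :
    (T.edgesOf K).ncard + 1 = (T.verticesOf K).ncard + K.ncard ∧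
      ∃ (q : k) (P : T.Side → k), (∀ s, P (T.next s) = ω ^ 2 * (P s - 1)) ∧
        (∀ s, P (T.mate s) = 1 - P s) ∧ ∀ s, s.1 ∉ K → P s = latticeDev ω q (e.map s) := by
  classical
  have h3 := pow_three_eq_one_of_sq hω
  have h6 : (-ω) ^ 6 = 1 := by linear_combination (ω ^ 3 + 1) * h3
  have h0 : ω ≠ 0 := by
    rintro rfl
    norm_num at hω
  have := hK.to_subtype
  have := (finite_edgesOf hK).to_subtype
  have hVfin : (T.verticesOf K \ T.exceptional).Finite :=
    (finite_verticesOf hK).subset Set.sdiff_subset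
  have := hVfin.to_subtype
  have hinj := edgeDefect_injective (e := e) hω hT ht₀ hd hs₁
  have hne : T.exceptional.Nonempty := Set.nonempty_of_ncard_ne_zero (by omega)
  have hsurj := vertexDefect_surjective (K := K) h0 hK hconn
    ⟨hne.some, e.exceptional_subset hne.some_mem, hne.some_mem⟩
  have hle : LinearMap.range (e.edgeDefect ω) ≤ LinearMap.ker (T.vertexDefect K ω) := by
    rintro _ ⟨x, rfl⟩
    exact vertexDefect_edgeDefect hω x
  have f1 : Module.finrank k (LinearMap.range (e.edgeDefect ω)) = K.ncard + 1 := by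
    have := Fintype.ofFinite K
    rw [LinearMap.finrank_range_of_inj hinj, Module.finrank_prod, Module.finrank_self,
      Module.finrank_fintype_fun_eq_card, ← Nat.card_eq_fintype_card, Nat.card_coe_set_eq]
  have f2 : Module.finrank k (T.edgesOf K → k) = (T.edgesOf K).ncard := by
    have := Fintype.ofFinite (T.edgesOf K)
    rw [Module.finrank_fintype_fun_eq_card, ← Nat.card_eq_fintype_card, Nat.card_coe_set_eq]
  have f3 : Module.finrank k (LinearMap.range (T.vertexDefect K ω)) =
      (T.verticesOf K \ T.exceptional).ncard := by
    have := Fintype.ofFinite ↥(T.verticesOf K \ T.exceptional)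
    rw [LinearMap.range_eq_top.2 hsurj, finrank_top,
      Module.finrank_fintype_fun_eq_card, ← Nat.card_eq_fintype_card, Nat.card_coe_set_eq]
  have f4 := Set.ncard_sdiff_add_ncard_of_subset e.exceptional_subset (finite_verticesOf hK)
  have f5 := LinearMap.finrank_range_add_finrank_ker (T.vertexDefect K ω)
  have f6 := Submodule.finrank_mono hle
  -- `F + 1 ≤ E - (V - 2)` by the inclusion and `E - (V - 2) ≤ F + 1` by Euler's inequality, so the
  -- dimensions agree.
  have hexact := Submodule.eq_of_le_of_finrank_eq hle (by omega)
  refine ⟨by omega, ?_⟩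
  -- The centre of the standard triangle is fixed by passing to the next side, so the constant `c₀`
  -- is a consistent first guess on each triangle of `K`.
  obtain ⟨c₀, hc₀⟩ : ∃ c₀ : k, c₀ = ω ^ 2 * (c₀ - 1) :=
    ⟨-ω ^ 2 / (1 - ω ^ 2), by field_simp; ring⟩
  set P₀ : T.Side → k := fun s => if s.1 ∈ K then c₀ else latticeDev ω 0 (e.map s) with hP₀
  have hin : ∀ s, s.1 ∈ K → P₀ s = c₀ := fun s h => if_pos h
  have hout : ∀ s, s.1 ∉ K → P₀ s = latticeDev ω 0 (e.map s) := fun s h => if_neg h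
  have hP₀next : ∀ s, P₀ (T.next s) = ω ^ 2 * (P₀ s - 1) := by
    intro s
    by_cases h : s.1 ∈ K
    · rw [hin s h, hin _ (by exact h), ← hc₀]
    · rw [hout s h, hout _ (by exact h), e.to_next s h, latticeDev_next hω]
  set z : T.Side → k := fun s => 1 - P₀ s - P₀ (T.mate s) with hz
  have hz0 : ∀ s ∉ T.sidesOf K, z s = 0 := by
    intro s hs
    have h1 : s.1 ∉ K := fun h' => hs (Or.inl h')
    have h2 : (T.mate s).1 ∉ K := fun h' => hs (Or.inr h')
    simp only [hz]
    rw [hout s h1, hout _ h2, e.to_mate s h1 h2, latticeDev_mate hω]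
    ring
  have hext : ∀ s, T.extendEdges K 1 (fun s => z s.1) s = z s := by
    refine extendEdges_restrict (fun s => ?_) hz0
    simp only [hz, T.mate_mate]
    ring
  have hzker : (fun s => z s.1) ∈ LinearMap.ker (T.vertexDefect K ω) := by
    rw [LinearMap.mem_ker]
    funext v
    have hrot : ∀ t, P₀ (T.rotate t) = -ω * P₀ t + -z (T.next.symm t) := by
      intro t
      have h := hP₀next (T.next.symm t)
      rw [Equiv.apply_symm_apply] at h
      simp only [hz]
      rw [rotate_apply]
      linear_combination ω * h + (P₀ (T.next.symm t) - 1) * h3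
    have h := sum_rotate_eq_zero (z := fun s => -z s) hrot h6 (rotate_six_someSide v.2.2).1
    simp only [mul_neg, Finset.sum_neg_distrib, neg_eq_zero] at h
    simp only [vertexDefect, LinearMap.coe_mk, AddHom.coe_mk, hext]
    exact h
  rw [← hexact] at hzker
  obtain ⟨x, hx⟩ := hzker
  have hx' : ∀ s, e.faceCochain ω x (T.mate s) + e.faceCochain ω x s = z s := by
    intro s
    rw [← extend_edgeDefect, hx, hext]
  refine ⟨x.2, fun s => P₀ s + e.faceCochain ω x s, fun s => ?_, fun s => ?_, fun s hs => ?_⟩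
  · dsimp only
    rw [hP₀next, faceCochain_next hω]
    ring
  · have h := hx' s
    simp only [hz] at h
    linear_combination h
  · dsimp only
    rw [hout s hs, faceCochain_of_not_mem x hs]
    unfold latticeDev
    ring

end OuterIso

/-! ### Comparison with the regular tiling -/

/-- In the regular triangulation at most six sides see a given point in a given position. -/
theorem ncard_latticeDev_le {k : Type*} [Field k] {ω : k} (hω : ω ^ 2 + ω + 1 = 0)
    (hlin : Function.Injective (latticePos ω)) (q x : k) :
    {t : regular.Side | latticeDev ω q t = x}.encard ≤ 6 := by
  have hinj : Set.InjOn (fun t : regular.Side => (t.1.2.2, t.2))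
      {t : regular.Side | latticeDev ω q t = x} := by
    rintro ⟨⟨m, n, b⟩, i⟩ h1 ⟨⟨m', n', b'⟩, i'⟩ h2 h
    -- The type of triangle and the number of the side fix the direction. Equal directions and equal
    -- values force equal starting points, hence equal triangles.
    obtain ⟨rfl, rfl⟩ := Prod.mk.inj h
    have hd : invDir ω ((m, n, b), i) = invDir ω ((m', n', b), i) := rfl
    have h3 : latticeDev ω q ((m, n, b), i) = latticeDev ω q ((m', n', b), i) :=
      Eq.trans h1 (Eq.symm h2)
    unfold latticeDev at h3
    rw [hd] at h3
    have h4 := mul_right_cancel₀ (invDir_ne_zero hω _) h3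
    have h5 := hlin (sub_right_inj.1 h4)
    change regularCorner (m, n, b) i = regularCorner (m', n', b) i at h5
    cases b <;> fin_cases i <;> simp [regularCorner] at h5 <;> obtain ⟨rfl, rfl⟩ := h5 <;> rfl
  rw [← hinj.encard_image]
  refine (Set.encard_le_encard (Set.subset_univ _)).trans ?_
  rw [Set.encard_univ]
  norm_num

/-- The norm form `a² + ab + b²` is positive definite. -/
theorem latticePos_injective {k : Type*} [Field k] [CharZero k] {ω : k}
    (hω : ω ^ 2 + ω + 1 = 0) : Function.Injective (latticePos ω) := by
  rintro ⟨a, b⟩ ⟨a', b'⟩ h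
  simp only [latticePos] at h
  have h1 : (((a - a') ^ 2 + (a - a') * (b - b') + (b - b') ^ 2 : ℤ) : k) = 0 := by
    push_cast
    linear_combination ((a - a' : k) + (b - b') * (-ω)) * h + ((b - b' : k) ^ 2) * hω
  have h2 : (a - a') ^ 2 + (a - a') * (b - b') + (b - b') ^ 2 = 0 := by exact_mod_cast h1
  have h3 : a - a' = 0 := by nlinarith [sq_nonneg (a - a'), sq_nonneg (a - a' + 2 * (b - b'))]
  have h4 : b - b' = 0 := by nlinarith [sq_nonneg (b - b'), sq_nonneg (b - b' + 2 * (a - a'))]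
  rw [sub_eq_zero] at h3 h4
  rw [h3, h4]

theorem exists_neg_primitiveRoot_six : ∃ ω : ℂ, ω ^ 2 + ω + 1 = 0 ∧ IsPrimitiveRoot (-ω) 6 := by
  have h : IsPrimitiveRoot (Complex.exp (2 * Real.pi * Complex.I / (6 : ℕ))) 6 :=
    Complex.isPrimitiveRoot_exp 6 (by norm_num)
  generalize Complex.exp (2 * Real.pi * Complex.I / (6 : ℕ)) = η at h
  refine ⟨-η, ?_, by rwa [neg_neg]⟩
  have h6 := h.pow_eq_one
  have h3 : η ^ 3 - 1 ≠ 0 := sub_ne_zero.2 (h.pow_ne_one_of_pos_of_lt (by norm_num) (by norm_num))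
  have h2 : η ^ 2 - 1 ≠ 0 := sub_ne_zero.2 (h.pow_ne_one_of_pos_of_lt (by norm_num) (by norm_num))
  have h1 : η + 1 ≠ 0 := by
    intro h1
    exact h2 (by linear_combination (η - 1) * h1)
  refine (mul_eq_zero.1 (?_ : (η ^ 3 - 1) * (η + 1) * _ = 0)).resolve_left (mul_ne_zero h3 h1)
  linear_combination h6

theorem exists_subset_box {B : Set regular.Face} (hB : B.Finite) :
    ∃ n : ℕ, 1 ≤ n ∧ B ⊆ box ((n : ℤ) - 1) := by
  obtain ⟨M, hM⟩ := (hB.image fun f : ℤ × ℤ × Bool => max |f.1| |f.2.1|).bddAbove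
  -- One unit is for the half-open range in `box`, one for the margin.
  refine ⟨M.toNat + 2, by omega, fun f hf => ?_⟩
  have h := hM ⟨f, hf, rfl⟩
  dsimp only at h
  have h1 := abs_le.1 ((le_max_left _ _).trans h)
  have h2 := abs_le.1 ((le_max_right _ _).trans h)
  change (_ ≤ f.1 ∧ f.1 < _) ∧ _ ≤ f.2.1 ∧ f.2.1 < _
  push_cast
  omega

/-- A triangulation of the plane with exactly two exceptional vertices that agrees with the regular
one outside finitely many triangles admits a development, and the two degrees add up to `12`. -/
theorem OuterIso.exists_global_development {T : TriangleGluing} (hT : T.IsPlane)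
    (htwo : T.exceptional.encard = 2) {A : Set T.Face} {B : Set regular.Face} (hA : A.Finite)
    (hB : B.Finite) (e : OuterIso T regular A B) {ω : ℂ} (hω : ω ^ 2 + ω + 1 = 0)
    (hprim : IsPrimitiveRoot (-ω) 6) :
    {s | T.start s ∈ T.exceptional}.ncard = 12 ∧ ∃ (K : Set T.Face) (L : Set regular.Face)
      (e' : OuterIso T regular K L) (q : ℂ) (P : T.Side → ℂ), K.Finite ∧
        (∀ s, P (T.next s) = ω ^ 2 * (P s - 1)) ∧ (∀ s, P (T.mate s) = 1 - P s) ∧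
        (∀ s, s.1 ∉ K → P s = latticeDev ω q (e'.map s)) ∧
        ∀ s, T.start s ∈ T.exceptional → P s = 0 := by
  obtain ⟨n, hn, hBn⟩ := exists_subset_box hB
  have hn' : (1 : ℤ) ≤ n := by exact_mod_cast hn
  have hK : (e.core n).Finite := e.finite_restrict hA (finite_box n)
  have hKne : (e.core n).Nonempty := by
    have ht : ((n : ℤ) - 1, (0 : ℤ), true) ∉ box ((n : ℤ) - 1) := by
      rw [mem_box]; omega
    have ht' : ((n : ℤ) - 1, (0 : ℤ), true) ∈ box (n : ℤ) := by
      rw [mem_box]; omega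
    exact ⟨_, e.inv_mem_core hBn (t := (((n : ℤ) - 1, (0 : ℤ), true), 0)) (fun h => ht (hBn h)) ht'⟩
  have hcount := ncard_edgesOf_lt hK hKne fun c h1 h2 => e.exists_core_potential hT hn' hBn h1 h2
  have h1 := two_mul_ncard_edgesOf hK
  rw [(e.coreIso hBn).ncard_boundarySides, ncard_boundarySides_box hn] at h1
  obtain ⟨h2, hfin⟩ := (e.coreIso hBn).ncard_start_exceptional hK hn
  have hexc : T.exceptional.ncard = 2 := by
    rw [Set.ncard, htwo]; rfl
  rw [hexc] at h2
  -- The counts above bound the sum of the two degrees by `12`. Since the other vertex uses at least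
  -- one side, `0 < d < 12`; as also `d ≠ 6`, the order `6` of `-ω` does not divide `d`.
  have hdeg : ∀ s, T.start s ∈ T.exceptional → ∃ d : ℕ, T.rotate^[d] s = s ∧ (-ω) ^ d ≠ 1 := by
    intro s hs
    obtain ⟨s', hs', hne⟩ : ∃ s', T.start s' ∈ T.exceptional ∧ T.start s' ≠ T.start s := by
      obtain ⟨u, v, huv, hexc'⟩ := Set.encard_eq_two.1 htwo
      obtain ⟨su, rfl⟩ := T.start_surjective u
      obtain ⟨sv, rfl⟩ := T.start_surjective v
      by_cases h : T.start s = T.start su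
      · exact ⟨sv, by simp [hexc'], by rw [h]; exact huv.symm⟩
      · exact ⟨su, by simp [hexc'], Ne.symm h⟩
    have hf1 : {t | T.start t = T.start s}.Finite := hfin.subset fun t ht => by
      change T.start t ∈ T.exceptional
      rw [show T.start t = T.start s from ht]; exact hs
    have hlt : {t | T.start t = T.start s}.ncard < {s | T.start s ∈ T.exceptional}.ncard := by
      refine Set.ncard_lt_ncard ⟨fun t ht => ?_, fun h => hne (h hs')⟩ hfin
      change T.start t ∈ T.exceptional
      rw [show T.start t = T.start s from ht]; exact hs
    have hpos : 0 < {t | T.start t = T.start s}.ncard := (Set.ncard_pos hf1).2 ⟨s, rfl⟩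
    have hd : T.degree (T.start s) = ({t | T.start t = T.start s}.ncard : ℕ) :=
      hf1.cast_ncard_eq.symm
    have hne6 : {t | T.start t = T.start s}.ncard ≠ 6 := by
      intro h
      rw [h] at hd
      exact hs hd
    refine ⟨_, (T.iterate_of_degree hd).1, ?_⟩
    rw [Ne, hprim.pow_eq_one_iff_dvd]
    rintro ⟨c, hc⟩
    omega
  obtain ⟨v, hv⟩ : T.exceptional.Nonempty := Set.nonempty_of_ncard_ne_zero (by omega)
  obtain ⟨t₀, rfl⟩ := T.start_surjective v
  obtain ⟨d, ht₀, hd⟩ := hdeg t₀ hv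
  have hs₁ : (((n : ℤ), (0 : ℤ), true) : ℤ × ℤ × Bool) ∉ box n := by
    rw [mem_box]; omega
  have hω1 : 1 - ω ^ 2 ≠ 0 := by
    have := hprim.pow_ne_one_of_pos_of_lt (l := 2) (by norm_num) (by norm_num)
    rw [neg_sq] at this
    exact sub_ne_zero.2 this.symm
  obtain ⟨h3, q, P, hnext, hmate, hout⟩ := (e.coreIso hBn).exists_development hK hT hω hω1
    (fun Q hQ ⟨v₀, hv₀, h₀⟩ v hv => e.core_vertex_induction hT hn' hBn hQ hv₀ h₀ hv) hexc ht₀ hd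
    ((e.coreIso hBn).inv_outer (((n : ℤ), (0 : ℤ), true), 0) hs₁) hcount
  refine ⟨by omega, _, _, e.coreIso hBn, q, P, hK, hnext, hmate, hout, fun s hs => ?_⟩
  obtain ⟨d, hds, hd⟩ := hdeg s hs
  have hrot : ∀ m, P (T.rotate^[m] s) = (-ω) ^ m * P s := by
    intro m
    induction m with
    | zero => simp
    | succ m ih =>
      have h := hnext (T.next.symm (T.rotate^[m] s))
      rw [Equiv.apply_symm_apply, ih] at h
      rw [Function.iterate_succ_apply', rotate_apply, hmate]
      linear_combination ω * h + (P (T.next.symm (T.rotate^[m] s)) - 1) *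
        pow_three_eq_one_of_sq hω
  have h := hrot d
  rw [hds] at h
  have h4 : (1 - (-ω) ^ d) * P s = 0 := by linear_combination h
  exact (mul_eq_zero.1 h4).resolve_left (sub_ne_zero.2 hd.symm)

/-- In the image of a development, translating by one maps sides to sides. -/
theorem exists_translation {k : Type*} [Field k] {T : TriangleGluing} {ω : k}
    (hω : ω ^ 2 + ω + 1 = 0) {P : T.Side → k} (hnext : ∀ s, P (T.next s) = ω ^ 2 * (P s - 1))
    (hmate : ∀ s, P (T.mate s) = 1 - P s) :
    ∃ W : T.Side → T.Side, Function.Injective W ∧ ∀ s, P (W s) = P s + 1 := by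
  have h3 := pow_three_eq_one_of_sq hω
  have hrot : ∀ s, P (T.rotate s) = -ω * P s := by
    intro s
    have h := hnext (T.next.symm s)
    rw [Equiv.apply_symm_apply] at h
    rw [rotate_apply, hmate]
    linear_combination ω * h + (P (T.next.symm s) - 1) * h3
  -- Three turns multiply `P` by `(-ω) ^ 3 = -1`, and the partner then gives `1 + P`. At a vertex of
  -- degree `6` this is one step straight back along the line of `s`.
  refine ⟨fun s => T.mate (T.rotate (T.rotate (T.rotate s))), fun s t h =>
    T.rotate.injective (T.rotate.injective (T.rotate.injective (T.mate_injective h))), fun s => ?_⟩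
  dsimp only
  rw [hmate, hrot, hrot, hrot]
  linear_combination P s * h3

/-- A triangulation of the plane with exactly two exceptional vertices is not isomorphic near
infinity to the regular triangulation. -/
theorem IsPlane.not_isoNearInfinity_regular {T : TriangleGluing} (hplane : T.IsPlane)
    (htwo : T.exceptional.encard = 2) : ¬ IsoNearInfinity T regular := by
  intro hiso
  have hne : T.exceptional.Nonempty := by
    rw [← Set.encard_ne_zero, htwo]
    norm_num
  obtain ⟨A, B, hA, hB, ⟨e⟩⟩ := hiso.exists_outerIso ⟨T.someSide hne.some⟩
  obtain ⟨ω, hω, hprim⟩ := exists_neg_primitiveRoot_six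
  obtain ⟨hcard, K, L, e', q, P, hK, hnext, hmate, hout, hzero⟩ :=
    e.exists_global_development hplane htwo hA hB hω hprim
  obtain ⟨W, hW, hPW⟩ := exists_translation hω hnext hmate
  have hiter : ∀ m s, P (W^[m] s) = P s + m := by
    intro m s
    induction m with
    | zero => simp
    | succ m ih =>
      rw [Function.iterate_succ_apply', hPW, ih]
      push_cast
      ring
  -- `P` takes finitely many values on `K`. Avoiding them places all sides with `P = m` outside `K`,
  -- where `P` is the regular development.
  obtain ⟨m, hm⟩ : ∃ m : ℕ, (m : ℂ) ∉ P '' {s | s.1 ∈ K} := by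
    have hf := (((finite_sides hK).image P).preimage (Nat.cast_injective (R := ℂ)).injOn)
    exact hf.exists_notMem
  set D := {s | T.start s ∈ T.exceptional} with hD
  have hval : ∀ s ∈ D, P (W^[m] s) = m := fun s hs => by rw [hiter, hzero s hs, zero_add]
  have houter : ∀ s ∈ D, (W^[m] s).1 ∉ K := fun s hs h => hm ⟨_, h, hval s hs⟩
  have hinj : Set.InjOn (fun s => e'.map (W^[m] s)) D := fun s hs t ht h =>
    hW.iterate m (e'.injOn_map (houter s hs) (houter t ht) h)
  have hsub : (fun s => e'.map (W^[m] s)) '' D ⊆ {t : regular.Side | latticeDev ω q t = m} := by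
    rintro _ ⟨s, hs, rfl⟩
    exact (hout _ (houter s hs)).symm.trans (hval s hs)
  have hle := (Set.encard_le_encard hsub).trans
    (ncard_latticeDev_le hω (latticePos_injective hω) q m)
  rw [hinj.encard_image] at hle
  have hfin : D.Finite := Set.finite_of_ncard_ne_zero (by omega)
  rw [← hfin.cast_ncard_eq, hcard] at hle
  exact absurd hle (by norm_num)

end TriangleGluing

theorem mainTheorem9 (T : TriangleGluing) (hplane : T.IsPlane)
    (htwo : T.exceptional.encard = 2) :
    ¬ TriangleGluing.IsoNearInfinity T TriangleGluing.regular := by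
  exact hplane.not_isoNearInfinity_regular htwo
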